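/- Let $P$ be a finite poset that is graded of rank one, i.e., every maximal chain of $P$ has exactly two elements. Let $H$ be the Hasse diagram of $P$, regarded as a simple graph on the vertex set $V=P$ (with $u,v$ adjacent if one covers the other); for $W\subseteq V$ let $H_W$ be the induced subgraph of $H$ on $W$, and let $\chi_{H_W}$ be its chromatic polynomial. Let $\mathcal{O}(P)\subset\mathbb{R}^P$ be the order polytope of $P$, i.e., the set of all order-preserving maps $P\to[0,1]$. Let $\mathrm{vis}(\mathcal{O}(P))$ be its visibility arrangement, i.e., the (finite) set of affine spans of the facets of $\mathcal{O}(P)$, and let $\chi_{\mathrm{vis}(\mathcal{O}(P))}(q)=\sum_{X}\mu(\hat 0,X)\,q^{\dim X}$ be its characteristic polynomial, where $X$ ranges over the poset of all nonempty intersections of hyperplanes of the arrangement (including $\hat 0=\mathbb{R}^P$) ordered by reverse inclusion and $\mu$ is the Möbius function of this poset. Let $v(\mathcal{O}(P))$ be the number of regions (connected components of the complement) of $\mathrm{vis}(\mathcal{O}(P))$. Then $$\chi_{\mathrm{vis}(\mathcal{O}(P))}(q)=\sum_{W\subseteq V}\chi_{H_W}(q-2),\qquad v(\mathcal{O}(P))=(-1)^{\#P}\sum_{W\subseteq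 V}\chi_{H_W}(-3),$$ and $v(\mathcal{O}(P))$ is also the number of visibility sets of facets of $\mathcal{O}(P)$, i.e., of sets of the form "all facets of $\mathcal{O}(P)$ visible from the outside from $x$" with $x\in\mathbb{R}^P$. Here a facet $F$ of $\mathcal{O}(P)$ is visible from $x$ if $x\notin\mathcal{O}(P)$ and, for every $y\in F$, no point of $\mathcal{O}(P)$ lies strictly between $x$ and $y$. -/

import Mathlib

/-! ### Chromatic polynomial of a finite simple graph -/

theorem exists_polynomial_card_maps {V : Type*} [Finite V] (L : List (V × V)) :
    ∀ r : V → V → Prop, ∃ p : Polynomial ℤ, ∀ q : ℕ,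
      p.eval (q : ℤ) = (Nat.card {f : V → Fin q //
        (∀ a b, r a b → f a = f b) ∧ ∀ e ∈ L, f e.1 ≠ f e.2} : ℤ) := by
  induction L with
  | nil =>
    intro r
    refine ⟨Polynomial.X ^ Nat.card (Quot r), fun q => ?_⟩
    have e : {f : V → Fin q // (∀ a b, r a b → f a = f b) ∧
        ∀ e ∈ ([] : List (V × V)), f e.1 ≠ f e.2} ≃ (Quot r → Fin q) :=
      { toFun := fun f => Quot.lift f.1 f.2.1
        invFun := fun g => ⟨fun v => g (Quot.mk r v),
          fun a b h => congrArg g (Quot.sound h), by simp⟩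
        left_inv := fun f => rfl
        right_inv := fun g => by funext x; induction x using Quot.ind; rfl }
    rw [Nat.card_congr e, Nat.card_fun]
    simp
  | cons e L ih =>
    intro r
    obtain ⟨p₁, h₁⟩ := ih r
    obtain ⟨p₂, h₂⟩ := ih (fun a b => r a b ∨ (a = e.1 ∧ b = e.2))
    refine ⟨p₁ - p₂, fun q => ?_⟩
    rw [Polynomial.eval_sub, h₁, h₂, sub_eq_iff_eq_add]
    norm_cast
    rw [← Set.coe_ofPred, ← Set.coe_ofPred, ← Set.coe_ofPred, Nat.card_coe_set_eq, Nat.card_coe_set_eq,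
      Nat.card_coe_set_eq, ← Set.ncard_union_eq _ (Set.toFinite _) (Set.toFinite _)]
    · congr 1
      ext f
      simp only [Set.mem_ofPred_eq, Set.mem_union, List.forall_mem_cons]
      constructor
      · rintro ⟨h, h'⟩
        by_cases he : f e.1 = f e.2
        · refine Or.inr ⟨fun a b hab => ?_, h'⟩
          rcases hab with hab | ⟨rfl, rfl⟩
          exacts [h a b hab, he]
        · exact Or.inl ⟨h, he, h'⟩
      · rintro (⟨h, -, h'⟩ | ⟨h, h'⟩)
        exacts [⟨h, h'⟩, ⟨fun a b hab => h a b (Or.inl hab), h'⟩]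
    · rw [Set.disjoint_left]
      rintro f ⟨-, h⟩ ⟨h', -⟩
      exact h e (by simp) (h' e.1 e.2 (Or.inr ⟨rfl, rfl⟩))

/-- The number of proper colorings of a finite graph with `q` colors is a polynomial in `q`. -/
theorem SimpleGraph.exists_chromaticPolynomial {V : Type*} [Finite V] (G : SimpleGraph V) :
    ∃ p : Polynomial ℤ, ∀ q : ℕ, p.eval (q : ℤ) = (Nat.card (G.Coloring (Fin q)) : ℤ) := by
  classical
  have := Fintype.ofFinite V
  obtain ⟨p, hp⟩ := exists_polynomial_card_maps
    ((Finset.univ.filter fun e : V × V => G.Adj e.1 e.2).toList) (fun _ _ => False)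
  refine ⟨p, fun q => ?_⟩
  rw [hp q]
  congr 1
  exact Nat.card_congr
    { toFun := fun f => SimpleGraph.Coloring.mk f.1 fun {v w} h => f.2.2 (v, w) (by simpa using h)
      invFun := fun c => ⟨c, by simp, fun e he => c.valid (by simpa using he)⟩
      left_inv := fun f => rfl
      right_inv := fun c => rfl }

/-- The chromatic polynomial of a finite simple graph: the polynomial whose value at each natural
number `q` is the number of proper colorings with `q` colors. -/
noncomputable def SimpleGraph.chromaticPolynomial {V : Type*} [Finite V] (G : SimpleGraph V) :
    Polynomial ℤ :=
  G.exists_chromaticPolynomial.choose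

theorem SimpleGraph.eval_chromaticPolynomial {V : Type*} [Finite V] (G : SimpleGraph V) (q : ℕ) :
    G.chromaticPolynomial.eval (q : ℤ) = (Nat.card (G.Coloring (Fin q)) : ℤ) :=
  G.exists_chromaticPolynomial.choose_spec q

/-! ### Arrangements of affine subspaces -/

/-- The intersection poset `L(A)`: all nonempty intersections of members of `A` (including the
whole space, as the empty intersection), ordered by reverse inclusion. -/
abbrev IntersectionPoset {E : Type*} [AddCommGroup E] [Module ℝ E]
    (A : Set (AffineSubspace ℝ E)) : Type _ :=
  {X : AffineSubspace ℝ E // (X : Set E).Nonempty ∧ ∃ B ⊆ A, X = sInf B}ᵒᵈ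

theorem IntersectionPoset.finite {E : Type*} [AddCommGroup E] [Module ℝ E]
    {A : Set (AffineSubspace ℝ E)} (hA : A.Finite) : Finite (IntersectionPoset A) :=
  Set.Finite.to_subtype <| (hA.finite_subsets.image sInf).subset <| by
    rintro X ⟨-, B, hB, rfl⟩
    exact ⟨B, hB, rfl⟩

/-- The minimum of the intersection poset: the whole space. -/
def IntersectionPoset.whole {E : Type*} [AddCommGroup E] [Module ℝ E]
    (A : Set (AffineSubspace ℝ E)) : IntersectionPoset A :=
  OrderDual.toDual ⟨⊤, ⟨0, trivial⟩, ∅, Set.empty_subset A, sInf_empty.symm⟩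

open Classical in
/-- The characteristic polynomial `∑ X ∈ L(A), μ(0̂, X) q ^ dim X` of a finite arrangement `A`,
where `μ` is the Möbius function of the intersection poset. -/
noncomputable def characteristicPolynomial {E : Type*} [AddCommGroup E] [Module ℝ E]
    [FiniteDimensional ℝ E] (A : Set (AffineSubspace ℝ E)) (hA : A.Finite) : Polynomial ℤ :=
  letI : Finite (IntersectionPoset A) := IntersectionPoset.finite hA
  letI : Fintype (IntersectionPoset A) := Fintype.ofFinite _
  letI : LocallyFiniteOrder (IntersectionPoset A) := Fintype.toLocallyFiniteOrder
  ∑ X : IntersectionPoset A,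
    Polynomial.C (IncidenceAlgebra.mu ℤ (IntersectionPoset.whole A) X) *
      Polynomial.X ^ Module.finrank ℝ (OrderDual.ofDual X).1.direction

/-- The regions of an arrangement: the connected components of the complement of the union of its
members. -/
def regions {E : Type*} [NormedAddCommGroup E] [NormedSpace ℝ E]
    (A : Set (AffineSubspace ℝ E)) : Set (Set E) :=
  {R | ∃ x ∈ (⋃ H ∈ A, (H : Set E))ᶜ, R = connectedComponentIn (⋃ H ∈ A, (H : Set E))ᶜ x}

/-! ### Facets and visibility -/

/-- The facets of a convex polytope `K`: its nonempty (exposed) faces of dimension `dim K - 1`. -/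
def facets {E : Type*} [NormedAddCommGroup E] [NormedSpace ℝ E] (K : Set E) : Set (Set E) :=
  {F | IsExposed ℝ K F ∧ F.Nonempty ∧
    Module.finrank ℝ (affineSpan ℝ F).direction + 1 =
      Module.finrank ℝ (affineSpan ℝ K).direction}

/-- The visibility arrangement of a convex polytope: the affine spans of its facets. -/
def visibilityArrangement {E : Type*} [NormedAddCommGroup E] [NormedSpace ℝ E] (K : Set E) :
    Set (AffineSubspace ℝ E) :=
  (fun F => affineSpan ℝ F) '' facets K

/-- The number `v(K)` of regions of the visibility arrangement. -/
noncomputable def visibilityNumber {E : Type*} [NormedAddCommGroup E] [NormedSpace ℝ E]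
    (K : Set E) : ℕ :=
  (regions (visibilityArrangement K)).ncard

/-- The set of facets of `K` visible (on the outside) from the point `x`: those facets `F` such
that `x` lies outside `K` and, for every `y ∈ F`, no point of `K` lies strictly between `x`
and `y`. -/
def visibleFacets {E : Type*} [NormedAddCommGroup E] [NormedSpace ℝ E] (K : Set E) (x : E) :
    Set (Set E) :=
  {F | F ∈ facets K ∧ x ∉ K ∧ ∀ y ∈ F, IsVisible ℝ K x y}

/-- The visibility sets of facets of `K`: the sets of facets visible from some point. -/
def visibilitySets {E : Type*} [NormedAddCommGroup E] [NormedSpace ℝ E] (K : Set E) :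
    Set (Set (Set E)) :=
  Set.range (visibleFacets K)

/-! ### Posets -/

/-- The order polytope of `P`: the order-preserving maps `P → [0, 1]`. -/
def orderPolytope (P : Type*) [PartialOrder P] : Set (P → ℝ) :=
  {f | Monotone f ∧ ∀ v, f v ∈ Set.Icc (0 : ℝ) 1}

/-- A poset is graded of rank one if every maximal chain has exactly two elements. -/
def IsGradedOfRankOne (P : Type*) [PartialOrder P] : Prop :=
  ∀ C : Set P, IsMaxChain (· ≤ ·) C → C.ncard = 2

/-! In rank one every element is either minimal or maximal but not both, and every strict
comparability is a cover. Hence the order polytope is cut out irredundantly by `x a ≤ x b` for each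
edge of the Hasse diagram, `0 ≤ x v` for minimal `v` and `x v ≤ 1` for the other `v`. The visibility
arrangement thus consists of the hyperplanes `x a = x b`, `x v = 0` and `x v = 1` of these
inequalities.

The characteristic polynomial is rewritten as Whitney's sum over subarrangements
(`characteristicPolynomial_eq_whitneyPolynomial`). All hyperplanes equate coordinates with each
other or with one of two constants, so the value at `q + 2` counts the maps to a set of `q` ordinary
and two special values that avoid every equation (`eval_whitneyPolynomial_card`). Each vertex avoids
one special value. If it is not ordinary it must take the other one, and this causes no conflict
along edges. Choosing the set `W` of ordinary vertices leaves a proper `q`-coloring of the induced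
subgraph, which gives the sum of chromatic polynomials (`card_avoiding`, `whitneyPolynomial_eq`).

Regions and visibility sets are both counted by sign patterns of the defining functionals, since a
facet is visible exactly from the negative side of its functional. Zaslavsky's theorem, proved by
deletion and restriction, counts these patterns by the Whitney polynomial at `-1`, where `X - 2`
becomes `-3`. -/

/-! ### Whitney's theorem for the characteristic polynomial. -/

open Polynomial in
/-- The signed sum `∑ (-1) ^ #B * X ^ dim (S ∩ ⋂ i ∈ B, H i)` over the subsets `B` of `s` for which
the intersection is nonempty. -/
noncomputable def whitneyPolynomial {E ι : Type*} [AddCommGroup E] [Module ℝ E]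
    (H : ι → AffineSubspace ℝ E) (s : Finset ι) (S : AffineSubspace ℝ E) : Polynomial ℤ :=
  open Classical in
  ∑ B ∈ s.powerset, if ((S ⊓ B.inf H : AffineSubspace ℝ E) : Set E).Nonempty then
    C ((-1) ^ B.card) * X ^ Module.finrank ℝ (S ⊓ B.inf H).direction else 0

theorem AffineSubspace.mem_finsetInf {E ι : Type*} [AddCommGroup E] [Module ℝ E]
    {H : ι → AffineSubspace ℝ E} {B : Finset ι} {x : E} :
    x ∈ B.inf H ↔ ∀ i ∈ B, x ∈ H i := by
  classical
  induction B using Finset.induction_on with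
  | empty => simp
  | insert a B _ ih => simp [Finset.inf_insert, AffineSubspace.mem_inf_iff, ih]

/-- The Möbius function `μ(o, ·)` from a minimum `o` is characterized by its partial sums. -/
theorem IncidenceAlgebra.mu_eq_of_sum_Icc {L : Type*} [PartialOrder L] [LocallyFiniteOrder L]
    [Finite L] [DecidableEq L] {o : L} (ho : ∀ x, o ≤ x) (g : L → ℤ)
    (hg : ∀ x, ∑ y ∈ Finset.Icc o x, g y = if o = x then 1 else 0) (x : L) :
    IncidenceAlgebra.mu ℤ o x = g x := by
  induction x using WellFoundedLT.induction with
  | ind x ih =>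
    have h := (IncidenceAlgebra.sum_Icc_mu_right (𝕜 := ℤ) o x).trans (hg x).symm
    rw [← Finset.Ico_insert_right (ho x), Finset.sum_insert (by simp),
      Finset.sum_insert (by simp), Finset.sum_congr rfl fun y hy => ih y (Finset.mem_Ico.1 hy).2]
      at h
    exact add_right_cancel h

open Polynomial in
/-- Whitney's theorem: the characteristic polynomial as a signed sum over subarrangements. -/
theorem characteristicPolynomial_eq_whitneyPolynomial {E ι : Type*} [AddCommGroup E] [Module ℝ E]
    [FiniteDimensional ℝ E] [Fintype ι] (H : ι → AffineSubspace ℝ E) (hH : ∀ i, H i ≠ ⊤)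
    {A : Set (AffineSubspace ℝ E)} (hA : A.Finite) (hAH : A = Set.range H) :
    characteristicPolynomial A hA = whitneyPolynomial H Finset.univ ⊤ := by
  classical
  let _ : Finite (IntersectionPoset A) := IntersectionPoset.finite hA
  let _ : Fintype (IntersectionPoset A) := Fintype.ofFinite _
  let _ : LocallyFiniteOrder (IntersectionPoset A) := Fintype.toLocallyFiniteOrder
  -- The candidate for the Möbius function: a signed count of the subfamilies whose intersection is
  -- exactly `X`.
  let g : IntersectionPoset A → ℤ := fun X =>
    ∑ B : Finset ι, if B.inf H = (OrderDual.ofDual X).1 then (-1) ^ B.card else 0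
  have hmem : ∀ B : Finset ι, ∃ C ⊆ A, B.inf H = sInf C := fun B =>
    ⟨H '' B, by rw [hAH]; exact Set.image_subset_range _ _, by
      rw [Finset.inf_eq_iInf, sInf_image]; rfl⟩
  have ho : ∀ X, IntersectionPoset.whole A ≤ X := fun X => by
    change (OrderDual.ofDual X).1 ≤ ⊤
    exact le_top
  have hle : ∀ X Y : IntersectionPoset A, Y ≤ X ↔ (OrderDual.ofDual X).1 ≤ (OrderDual.ofDual Y).1 :=
    fun X Y => Iff.rfl
  have hμ : ∀ X, IncidenceAlgebra.mu ℤ (IntersectionPoset.whole A) X = g X := by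
    refine IncidenceAlgebra.mu_eq_of_sum_Icc ho g fun X => ?_
    -- A subfamily has only one intersection, so it contributes to exactly one `Y`, and that `Y`
    -- lies below `X` iff every member contains `X`.
    have key : ∀ B : Finset ι, (∑ Y ∈ Finset.Icc (IntersectionPoset.whole A) X,
        if B.inf H = (OrderDual.ofDual Y).1 then (-1 : ℤ) ^ B.card else 0) =
        if ∀ i ∈ B, (OrderDual.ofDual X).1 ≤ H i then (-1) ^ B.card else 0 := by
      intro B
      split_ifs with hB
      · have hXB : (OrderDual.ofDual X).1 ≤ B.inf H := Finset.le_inf hB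
        let Y₀ : IntersectionPoset A :=
          OrderDual.toDual ⟨B.inf H, (OrderDual.ofDual X).2.1.mono hXB, hmem B⟩
        rw [Finset.sum_eq_single_of_mem Y₀ (Finset.mem_Icc.2 ⟨ho _, (hle _ _).2 hXB⟩)]
        · exact if_pos rfl
        · intro Y _ hY
          refine if_neg fun h => hY ?_
          exact congrArg OrderDual.toDual (Subtype.ext h.symm)
      · refine Finset.sum_eq_zero fun Y hY => if_neg fun h => hB fun i hi => ?_
        exact ((hle _ _).1 (Finset.mem_Icc.1 hY).2).trans (h ▸ Finset.inf_le hi)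
    -- What remains is the alternating sum over all sets of hyperplanes containing `X`. It vanishes
    -- unless there are none, that is, unless `X` is the whole space.
    rw [Finset.sum_comm, Finset.sum_congr rfl fun B _ => key B, ← Finset.sum_filter]
    have hfil : (Finset.univ.filter fun B : Finset ι => ∀ i ∈ B, (OrderDual.ofDual X).1 ≤ H i) =
        (Finset.univ.filter fun i => (OrderDual.ofDual X).1 ≤ H i).powerset := by
      ext B
      simp [Finset.subset_iff]
    rw [hfil, Finset.sum_powerset_neg_one_pow_card]
    congr 1
    rw [Finset.filter_eq_empty_iff, eq_iff_iff]
    constructor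
    · intro h
      obtain ⟨C, hC, hXC⟩ := (OrderDual.ofDual X).2.2
      have hC0 : C = ∅ := by
        refine Set.eq_empty_of_forall_notMem fun c hc => ?_
        obtain ⟨i, rfl⟩ := hAH ▸ hC hc
        exact h (Finset.mem_univ i) (hXC ▸ sInf_le hc)
      refine congrArg OrderDual.toDual (Subtype.ext ?_)
      change ⊤ = (OrderDual.ofDual X).1
      rw [hXC, hC0, sInf_empty]
    · rintro rfl i _ h
      exact hH i (top_le_iff.1 h)
  have hdef : characteristicPolynomial A hA = ∑ X : IntersectionPoset A,
      C (IncidenceAlgebra.mu ℤ (IntersectionPoset.whole A) X) *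
        Polynomial.X ^ Module.finrank ℝ (OrderDual.ofDual X).1.direction := by
    unfold characteristicPolynomial
    congr!
  rw [hdef, whitneyPolynomial, Finset.powerset_univ]
  simp_rw [hμ, g, map_sum, Finset.sum_mul]
  rw [Finset.sum_comm]
  refine Finset.sum_congr rfl fun B _ => ?_
  rw [top_inf_eq]
  split_ifs with hB
  · rw [Finset.sum_eq_single_of_mem (OrderDual.toDual ⟨B.inf H, hB, hmem B⟩) (Finset.mem_univ _)]
    · rw [if_pos (by rfl)]
      rfl
    · intro Y _ hY
      rw [if_neg fun h => hY (congrArg OrderDual.toDual (Subtype.ext h.symm)), map_zero, zero_mul]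
  · refine Finset.sum_eq_zero fun Y _ => ?_
    rw [if_neg fun h : B.inf H = (OrderDual.ofDual Y).1 => hB (h ▸ (OrderDual.ofDual Y).2.1),
      map_zero, zero_mul]

/-! ### Affine functionals and their sign patterns. -/

/-- The affine subspace on which an affine functional vanishes. -/
def AffineMap.zeroLocus {E : Type*} [AddCommGroup E] [Module ℝ E] (f : E →ᵃ[ℝ] ℝ) :
    AffineSubspace ℝ E :=
  (AffineSubspace.mk' 0 ⊥).comap f

@[simp]
theorem AffineMap.mem_zeroLocus {E : Type*} [AddCommGroup E] [Module ℝ E] {f : E →ᵃ[ℝ] ℝ} {x : E} :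
    x ∈ f.zeroLocus ↔ f x = 0 := by
  simp [AffineMap.zeroLocus, AffineSubspace.mem_comap, AffineSubspace.mem_mk']

theorem AffineMap.direction_zeroLocus {E : Type*} [AddCommGroup E] [Module ℝ E] {f : E →ᵃ[ℝ] ℝ}
    {x : E} (hx : f x = 0) : f.zeroLocus.direction = LinearMap.ker f.linear := by
  ext v
  rw [← AffineSubspace.vadd_mem_iff_mem_direction v (AffineMap.mem_zeroLocus.2 hx),
    AffineMap.mem_zeroLocus, f.map_vadd, hx, LinearMap.mem_ker]
  simp

/-- Intersecting with a transversal hyperplane lowers the dimension by one. -/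
theorem AffineMap.finrank_direction_inf_zeroLocus {E : Type*} [AddCommGroup E] [Module ℝ E]
    [FiniteDimensional ℝ E] {f : E →ᵃ[ℝ] ℝ} {S : AffineSubspace ℝ E} {x y : E} (hx : x ∈ S)
    (hfx : f x = 0) (hy : y ∈ S) (hfy : f y ≠ 0) :
    Module.finrank ℝ (S ⊓ f.zeroLocus).direction + 1 = Module.finrank ℝ S.direction := by
  have hg : f.linear ∘ₗ S.direction.subtype ≠ 0 := fun h => by
    have h1 := LinearMap.congr_fun h ⟨y -ᵥ x, AffineSubspace.vsub_mem_direction hy hx⟩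
    have h2 : f.linear (y -ᵥ x) = 0 := h1
    rw [AffineMap.linearMap_vsub, hfx] at h2
    exact hfy (by simpa using h2)
  rw [AffineSubspace.direction_inf_of_mem hx (AffineMap.mem_zeroLocus.2 hfx),
    AffineMap.direction_zeroLocus hfx, ← Module.Dual.finrank_ker_add_one_of_ne_zero hg,
    LinearMap.ker_comp, ← Submodule.map_comap_subtype, Submodule.finrank_map_subtype_eq]

/-- Moving slightly away from `x` keeps the strict signs of finitely many affine functionals. -/
theorem AffineMap.eventually_lineMap_sign {E ι : Type*} [AddCommGroup E] [Module ℝ E]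
    (l : ι → E →ᵃ[ℝ] ℝ) (s : Finset ι) (x y : E) :
    ∀ᶠ t in nhds (0 : ℝ), ∀ i ∈ s, (0 < l i x → 0 < l i (AffineMap.lineMap x y t)) ∧
      (l i x < 0 → l i (AffineMap.lineMap x y t) < 0) := by
  rw [Filter.eventually_all_finset]
  intro i _
  have hc : Filter.Tendsto (fun t : ℝ => l i (AffineMap.lineMap x y t)) (nhds 0)
      (nhds (l i x)) := by
    have : Continuous fun t : ℝ => l i (AffineMap.lineMap x y t) := by
      simp only [AffineMap.apply_lineMap]
      exact AffineMap.lineMap_continuous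
    simpa using this.tendsto 0
  refine Filter.Eventually.and ?_ ?_
  · by_cases h : 0 < l i x
    · filter_upwards [hc.eventually (lt_mem_nhds h)] with t ht _ using ht
    · exact Filter.Eventually.of_forall fun _ h' => absurd h' h
  · by_cases h : l i x < 0
    · filter_upwards [hc.eventually (gt_mem_nhds h)] with t ht _ using ht
    · exact Filter.Eventually.of_forall fun _ h' => absurd h' h

open Classical in
/-- The indices in `s` of the functionals negative at `x`. -/
noncomputable def negIndices {E ι : Type*} [AddCommGroup E] [Module ℝ E] (l : ι → E →ᵃ[ℝ] ℝ)
    (s : Finset ι) (x : E) : Finset ι :=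
  s.filter fun i => l i x < 0

/-- The sign patterns realized on `S` by points at which no functional with index in `s`
vanishes. -/
def signPatterns {E ι : Type*} [AddCommGroup E] [Module ℝ E] (l : ι → E →ᵃ[ℝ] ℝ)
    (s : Finset ι) (S : Set E) : Set (Finset ι) :=
  negIndices l s '' {x ∈ S | ∀ i ∈ s, l i x ≠ 0}

theorem mem_negIndices {E ι : Type*} [AddCommGroup E] [Module ℝ E] {l : ι → E →ᵃ[ℝ] ℝ}
    {s : Finset ι} {x : E} {i : ι} : i ∈ negIndices l s x ↔ i ∈ s ∧ l i x < 0 := by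
  simp [negIndices]

theorem finite_signPatterns {E ι : Type*} [AddCommGroup E] [Module ℝ E] (l : ι → E →ᵃ[ℝ] ℝ)
    (s : Finset ι) (S : Set E) : (signPatterns l s S).Finite := by
  refine (Finset.finite_toSet s.powerset).subset ?_
  rintro _ ⟨x, -, rfl⟩
  simp only [Finset.coe_powerset, Set.mem_preimage, Set.mem_powerset_iff, Finset.coe_subset]
  exact fun i hi => (mem_negIndices.1 hi).1

theorem negIndices_eq_iff {E ι : Type*} [AddCommGroup E] [Module ℝ E] {l : ι → E →ᵃ[ℝ] ℝ}
    {s : Finset ι} {x y : E} :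
    negIndices l s x = negIndices l s y ↔ ∀ i ∈ s, (l i x < 0 ↔ l i y < 0) := by
  simp [Finset.ext_iff, mem_negIndices]

theorem negIndices_eq_of_sign {E ι : Type*} [AddCommGroup E] [Module ℝ E] {l : ι → E →ᵃ[ℝ] ℝ}
    {s : Finset ι} {x y : E} (hx : ∀ i ∈ s, l i x ≠ 0)
    (h : ∀ i ∈ s, (0 < l i x → 0 < l i y) ∧ (l i x < 0 → l i y < 0)) :
    negIndices l s y = negIndices l s x := by
  refine negIndices_eq_iff.2 fun i hi => ⟨fun h' => ?_, (h i hi).2⟩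
  by_contra h0
  exact absurd ((h i hi).1 (lt_of_le_of_ne (not_lt.1 h0) (hx i hi).symm)) h'.not_gt

/-- Patterns without `a` come from the positive side of `l a`. Those with `a` come from the negative
side after inserting `a`, which is injective because `a ∉ s`. -/
theorem ncard_signPatterns_insert_eq_pos_add_neg {E ι : Type*} [AddCommGroup E] [Module ℝ E]
    [DecidableEq ι] {l : ι → E →ᵃ[ℝ] ℝ} {s : Finset ι} {S : Set E} {a : ι} (ha : a ∉ s) :
    (signPatterns l (insert a s) S).ncard =
      (signPatterns l s (S ∩ {x | 0 < l a x})).ncard +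
        (signPatterns l s (S ∩ {x | l a x < 0})).ncard := by
  have hpos : ∀ x, 0 < l a x → negIndices l (insert a s) x = negIndices l s x := by
    intro x hx
    ext i
    simp only [mem_negIndices, Finset.mem_insert]
    constructor
    · rintro ⟨rfl | h, h'⟩
      exacts [absurd h' hx.not_gt, ⟨h, h'⟩]
    · exact fun h => ⟨Or.inr h.1, h.2⟩
  have hneg : ∀ x, l a x < 0 → negIndices l (insert a s) x = insert a (negIndices l s x) := by
    intro x hx
    ext i
    simp only [mem_negIndices, Finset.mem_insert]
    constructor
    · rintro ⟨rfl | h, h'⟩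
      exacts [Or.inl rfl, Or.inr ⟨h, h'⟩]
    · rintro (rfl | h)
      exacts [⟨Or.inl rfl, hx⟩, ⟨Or.inr h.1, h.2⟩]
  have hnot : ∀ N ∈ signPatterns l s (S ∩ {x | l a x < 0}), a ∉ N := by
    rintro _ ⟨x, -, rfl⟩ h
    exact ha (mem_negIndices.1 h).1
  have hunion : signPatterns l (insert a s) S = signPatterns l s (S ∩ {x | 0 < l a x}) ∪
      insert a '' signPatterns l s (S ∩ {x | l a x < 0}) := by
    ext N
    constructor
    · rintro ⟨x, ⟨hxS, hx⟩, rfl⟩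
      have hx' : ∀ i ∈ s, l i x ≠ 0 := fun i hi => hx i (Finset.mem_insert_of_mem hi)
      rcases lt_or_gt_of_ne (hx a (Finset.mem_insert_self a s)) with h | h
      · exact Or.inr ⟨_, ⟨x, ⟨⟨hxS, h⟩, hx'⟩, rfl⟩, (hneg x h).symm⟩
      · exact Or.inl ⟨x, ⟨⟨hxS, h⟩, hx'⟩, (hpos x h).symm⟩
    · rintro (⟨x, ⟨⟨hxS, h⟩, hx⟩, rfl⟩ | ⟨_, ⟨x, ⟨⟨hxS, h⟩, hx⟩, rfl⟩, rfl⟩)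
      · exact ⟨x, ⟨hxS, (Finset.forall_mem_insert _ _ _).2 ⟨ne_of_gt h, hx⟩⟩, hpos x h⟩
      · exact ⟨x, ⟨hxS, (Finset.forall_mem_insert _ _ _).2 ⟨ne_of_lt h, hx⟩⟩, hneg x h⟩
  rw [hunion, Set.ncard_union_eq _ (finite_signPatterns ..) ((finite_signPatterns ..).image _),
    Set.InjOn.ncard_image]
  · intro N hN M hM h
    rw [← Finset.erase_insert (hnot N hN), ← Finset.erase_insert (hnot M hM), h]
  · rw [Set.disjoint_left]
    rintro _ ⟨x, -, rfl⟩ ⟨M, -, h⟩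
    exact ha (mem_negIndices.1 (h ▸ Finset.mem_insert_self a M)).1

/-- A sign pattern realized on the hyperplane `l a = 0` is realized on either side of it. -/
theorem exists_sign_of_mem_zeroLocus {E ι : Type*} [AddCommGroup E] [Module ℝ E]
    {l : ι → E →ᵃ[ℝ] ℝ} {s : Finset ι} {S : AffineSubspace ℝ E} {a : ι} {x y : E}
    (hx : x ∈ S) (hax : l a x = 0) (hs : ∀ i ∈ s, l i x ≠ 0) (hy : y ∈ S) (hay : l a y ≠ 0) :
    negIndices l s x ∈ signPatterns l s (S ∩ {x | 0 < l a x}) ∧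
      negIndices l s x ∈ signPatterns l s (S ∩ {x | l a x < 0}) := by
  obtain ⟨e, he, h⟩ := Metric.eventually_nhds_iff.1 (AffineMap.eventually_lineMap_sign l s x y)
  have hla : ∀ t : ℝ, l a (AffineMap.lineMap x y t) = t * l a y := by
    intro t
    rw [AffineMap.apply_lineMap, hax, AffineMap.lineMap_apply]
    simp
  have key : ∀ t : ℝ, |t| < e → ∀ i ∈ s, l i (AffineMap.lineMap x y t) ≠ 0 := by
    intro t ht i hi
    have := h (y := t) (by simpa using ht) i hi
    rcases lt_or_gt_of_ne (hs i hi) with h' | h'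
    exacts [(this.2 h').ne, (this.1 h').ne']
  have main : ∀ t : ℝ, |t| < e → ∀ Q : Set E, AffineMap.lineMap x y t ∈ Q →
      negIndices l s x ∈ signPatterns l s (S ∩ Q) := fun t ht Q hQ =>
    ⟨AffineMap.lineMap x y t, ⟨⟨AffineMap.lineMap_mem t hx hy, hQ⟩, key t ht⟩,
      negIndices_eq_of_sign hs (h (by simpa using ht))⟩
  have hp : |e / 2| < e := by rw [abs_of_pos (by positivity)]; linarith
  have hm : |-(e / 2)| < e := by rwa [abs_neg]
  rcases lt_or_gt_of_ne hay with h' | h'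
  · refine ⟨main _ hm _ ?_, main _ hp _ ?_⟩
    · rw [Set.mem_ofPred_eq, hla]; nlinarith
    · rw [Set.mem_ofPred_eq, hla]; nlinarith
  · refine ⟨main _ hp _ ?_, main _ hm _ ?_⟩
    · rw [Set.mem_ofPred_eq, hla]; positivity
    · rw [Set.mem_ofPred_eq, hla]; nlinarith

/-- A cell of the old arrangement is cut in two exactly when the new hyperplane meets it, so the
number of cells grows by the number of cells induced on that hyperplane. -/
theorem ncard_signPatterns_insert {E ι : Type*} [AddCommGroup E] [Module ℝ E] [DecidableEq ι]
    {l : ι → E →ᵃ[ℝ] ℝ} {s : Finset ι} {S : AffineSubspace ℝ E} {a : ι} (ha : a ∉ s) {y : E}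
    (hy : y ∈ S) (hay : l a y ≠ 0) :
    (signPatterns l (insert a s) S).ncard =
      (signPatterns l s S).ncard +
        (signPatterns l s (S ⊓ (l a).zeroLocus : AffineSubspace ℝ E)).ncard := by
  rw [ncard_signPatterns_insert_eq_pos_add_neg ha,
    ← Set.ncard_union_add_ncard_inter _ _ (finite_signPatterns ..) (finite_signPatterns ..)]
  -- Patterns realized on at least one side are all the old patterns; those realized on both sides
  -- are the ones realized on the hyperplane.
  congr 2
  · ext N
    constructor
    · rintro (⟨x, ⟨⟨hxS, -⟩, hx⟩, rfl⟩ | ⟨x, ⟨⟨hxS, -⟩, hx⟩, rfl⟩) <;> exact ⟨x, ⟨hxS, hx⟩, rfl⟩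
    · rintro ⟨x, ⟨hxS, hx⟩, rfl⟩
      rcases lt_trichotomy (l a x) 0 with h | h | h
      · exact Or.inr ⟨x, ⟨⟨hxS, h⟩, hx⟩, rfl⟩
      · exact Or.inl (exists_sign_of_mem_zeroLocus hxS h hx hy hay).1
      · exact Or.inl ⟨x, ⟨⟨hxS, h⟩, hx⟩, rfl⟩
  · ext N
    constructor
    · rintro ⟨⟨x, ⟨⟨hxS, hax⟩, hx⟩, rfl⟩, ⟨z, ⟨⟨hzS, haz⟩, hz⟩, hxz⟩⟩
      rw [Set.mem_ofPred_eq] at hax haz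
      have hd : 0 < l a x - l a z := by linarith
      -- The parameter at which the segment from `x` to `z` crosses `l a = 0`. Signs shared by the
      -- two endpoints persist there by convexity.
      set t : ℝ := l a x / (l a x - l a z) with ht
      have ht0 : 0 < t := div_pos hax hd
      have ht1 : t < 1 := (div_lt_one hd).2 (by linarith)
      have hval : ∀ i, l i (AffineMap.lineMap x z t) = (1 - t) * l i x + t * l i z := by
        intro i
        rw [AffineMap.apply_lineMap, AffineMap.lineMap_apply]
        simp only [vsub_eq_sub, smul_eq_mul, vadd_eq_add]
        ring
      have hsgn := negIndices_eq_iff.1 hxz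
      have hsign : ∀ i ∈ s, (0 < l i x → 0 < l i (AffineMap.lineMap x z t)) ∧
          (l i x < 0 → l i (AffineMap.lineMap x z t) < 0) := by
        intro i hi
        rw [hval]
        constructor
        · intro h
          have hz' : 0 < l i z := lt_of_le_of_ne
            (not_lt.1 fun h' => h.not_gt ((hsgn i hi).1 h')) (hz i hi).symm
          have := mul_pos (sub_pos.2 ht1) h
          have := mul_pos ht0 hz'
          linarith
        · intro h
          have := mul_pos (sub_pos.2 ht1) (neg_pos.2 h)
          have := mul_pos ht0 (neg_pos.2 ((hsgn i hi).2 h))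
          linarith
      refine ⟨AffineMap.lineMap x z t, ⟨?_, ?_⟩, negIndices_eq_of_sign hx hsign⟩
      · refine (AffineSubspace.mem_inf_iff _ _ _).2 ⟨AffineMap.lineMap_mem t hxS hzS, ?_⟩
        rw [AffineMap.mem_zeroLocus, hval, ht]
        field_simp
        ring
      · intro i hi
        rcases lt_or_gt_of_ne (hx i hi) with h' | h'
        exacts [((hsign i hi).2 h').ne, ((hsign i hi).1 h').ne']
    · rintro ⟨x, ⟨hxS, hx⟩, rfl⟩
      obtain ⟨h1, h2⟩ := (AffineSubspace.mem_inf_iff _ _ _).1 hxS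
      exact exists_sign_of_mem_zeroLocus h1 (AffineMap.mem_zeroLocus.1 h2) hx hy hay

/-! ### Zaslavsky's theorem. -/

/-- Deletion and restriction: a subset containing `a` contributes the opposite sign and has `H a`
absorbed into `S`. -/
theorem whitneyPolynomial_insert {E ι : Type*} [AddCommGroup E] [Module ℝ E] [DecidableEq ι]
    (H : ι → AffineSubspace ℝ E) {s : Finset ι} (S : AffineSubspace ℝ E) {a : ι} (ha : a ∉ s) :
    whitneyPolynomial H (insert a s) S =
      whitneyPolynomial H s S - whitneyPolynomial H s (S ⊓ H a) := by
  unfold whitneyPolynomial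
  rw [Finset.sum_powerset_insert ha, sub_eq_add_neg, ← Finset.sum_neg_distrib]
  congr 1
  refine Finset.sum_congr rfl fun B hB => ?_
  have haB : a ∉ B := fun h => ha (Finset.mem_powerset.1 hB h)
  rw [Finset.inf_insert, ← inf_assoc, Finset.card_insert_of_notMem haB, pow_succ]
  split_ifs <;> simp

/-- Zaslavsky's theorem, relative to an affine subspace. -/
theorem eval_whitneyPolynomial_neg_one {E ι : Type*} [AddCommGroup E] [Module ℝ E]
    [FiniteDimensional ℝ E] (l : ι → E →ᵃ[ℝ] ℝ) (s : Finset ι) (S : AffineSubspace ℝ E) :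
    (whitneyPolynomial (fun i => (l i).zeroLocus) s S).eval (-1) =
      (-1) ^ Module.finrank ℝ S.direction * ((signPatterns l s S).ncard : ℤ) := by
  classical
  induction s using Finset.induction_on generalizing S with
  | empty =>
    rw [whitneyPolynomial, Finset.powerset_empty, Finset.sum_singleton, Finset.inf_empty,
      inf_top_eq]
    have hn : negIndices l ∅ = fun _ => ∅ := funext fun x => by simp [negIndices]
    rcases (S : Set E).eq_empty_or_nonempty with h | h
    · have h0 : signPatterns l ∅ (S : Set E) = ∅ := by simp [signPatterns, h]
      rw [h0, if_neg (by simp [h])]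
      simp
    · have h1 : signPatterns l ∅ (S : Set E) = {∅} := by
        have h' : {x : E | x ∈ (S : Set E) ∧ ∀ i ∈ (∅ : Finset ι), l i x ≠ 0}.Nonempty := by
          simpa using h
        rw [signPatterns, hn, h'.image_const]
      rw [h1, if_pos h]
      simp
  | insert a s ha ih =>
    rw [whitneyPolynomial_insert _ _ ha, Polynomial.eval_sub, ih, ih]
    -- If `l a` vanishes on `S`, deletion and restriction cancel and no pattern is realized.
    by_cases hS : ∀ y ∈ S, l a y = 0
    · have h1 : S ⊓ (l a).zeroLocus = S :=
        inf_eq_left.2 fun y hy => AffineMap.mem_zeroLocus.2 (hS y hy)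
      have h2 : signPatterns l (insert a s) (S : Set E) = ∅ := by
        refine Set.eq_empty_of_forall_notMem ?_
        rintro _ ⟨x, ⟨hxS, hx⟩, -⟩
        exact hx a (Finset.mem_insert_self a s) (hS x hxS)
      rw [h1, h2]
      simp
    · push Not at hS
      obtain ⟨y, hy, hay⟩ := hS
      rw [ncard_signPatterns_insert ha hy hay]
      by_cases hx : ∃ x ∈ S, l a x = 0
      · obtain ⟨x, hx, hax⟩ := hx
        -- The drop of one in dimension turns the minus sign of the polynomial recursion into the
        -- plus sign of the counting recursion.
        rw [← AffineMap.finrank_direction_inf_zeroLocus hx hax hy hay]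
        push_cast
        ring
      · have h0 : signPatterns l s ((S ⊓ (l a).zeroLocus : AffineSubspace ℝ E) : Set E) = ∅ := by
          refine Set.eq_empty_of_forall_notMem ?_
          rintro _ ⟨x, ⟨hxS, -⟩, -⟩
          obtain ⟨h1, h2⟩ := (AffineSubspace.mem_inf_iff _ _ _).1 hxS
          exact hx ⟨x, h1, AffineMap.mem_zeroLocus.1 h2⟩
        rw [h0]
        simp

/-! ### Regions as cells of constant sign pattern. -/

/-- The regions of a finite hyperplane arrangement correspond to the realized sign patterns. -/
theorem exists_bijOn_regions {E ι : Type*} [NormedAddCommGroup E] [NormedSpace ℝ E]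
    [FiniteDimensional ℝ E] [Fintype ι] (l : ι → E →ᵃ[ℝ] ℝ) :
    ∃ f : Finset ι → Set E, Set.BijOn f (signPatterns l Finset.univ Set.univ)
      (regions (Set.range fun i => (l i).zeroLocus)) := by
  classical
  set U : Set E := (⋃ H ∈ Set.range fun i => (l i).zeroLocus, (H : Set E))ᶜ with hU
  have hmem : ∀ x, x ∈ U ↔ ∀ i, l i x ≠ 0 := by
    intro x
    simp [hU]
  have hcont : ∀ i, Continuous (l i) := fun i => (l i).continuous_of_finiteDimensional
  -- A connected set avoiding all hyperplanes cannot change a sign, by the intermediate value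
  -- theorem. Conversely a sign cell is convex, hence connected.
  have hcomp : ∀ x ∈ U, connectedComponentIn U x =
      {y ∈ U | negIndices l Finset.univ y = negIndices l Finset.univ x} := by
    intro x hx
    apply Set.Subset.antisymm
    · intro y hy
      have hyU := connectedComponentIn_subset U x hy
      refine ⟨hyU, negIndices_eq_iff.2 fun i _ => ?_⟩
      have hpre := (isPreconnected_connectedComponentIn (F := U) (x := x)).image (l i)
        (hcont i).continuousOn
      have hord := hpre.ordConnected
      have hx' := Set.mem_image_of_mem (l i) (mem_connectedComponentIn hx)
      have hy' := Set.mem_image_of_mem (l i) hy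
      have h0 : (0 : ℝ) ∉ l i '' connectedComponentIn U x := by
        rintro ⟨z, hz, hz0⟩
        exact (hmem z).1 (connectedComponentIn_subset U x hz) i hz0
      have hxi := (hmem x).1 hx i
      have hyi := (hmem y).1 hyU i
      constructor
      · intro h
        by_contra h'
        exact h0 (hord.out hy' hx' ⟨h.le, not_lt.1 h'⟩)
      · intro h
        by_contra h'
        exact h0 (hord.out hx' hy' ⟨h.le, not_lt.1 h'⟩)
    · have hcell : {y ∈ U | negIndices l Finset.univ y = negIndices l Finset.univ x} =
          ⋂ i, l i ⁻¹' (if l i x < 0 then Set.Iio 0 else Set.Ioi 0) := by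
        ext y
        simp only [Set.mem_ofPred_eq, hmem, negIndices_eq_iff, Set.mem_iInter, Set.mem_preimage,
          Finset.mem_univ, true_imp_iff, ← forall_and]
        refine forall_congr' fun i => ?_
        split_ifs with h
        · simp only [h, iff_true, Set.mem_Iio, and_iff_right_iff_imp]
          exact ne_of_lt
        · simp only [h, iff_false, Set.mem_Ioi, not_lt]
          exact ⟨fun h => lt_of_le_of_ne h.2 h.1.symm, fun h => ⟨h.ne', h.le⟩⟩
      refine IsPreconnected.subset_connectedComponentIn ?_ ⟨hx, rfl⟩ fun y hy => hy.1
      rw [hcell]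
      refine (convex_iInter fun i => Convex.affine_preimage (l i) ?_).isPreconnected
      split_ifs
      exacts [convex_Iio 0, convex_Ioi 0]
  refine ⟨fun N => {y ∈ U | negIndices l Finset.univ y = N}, ?_, ?_, ?_⟩
  · rintro _ ⟨x, ⟨-, hx⟩, rfl⟩
    have hxU := (hmem x).2 fun i => hx i (Finset.mem_univ i)
    exact ⟨x, hxU, (hcomp x hxU).symm⟩
  · rintro _ ⟨x, ⟨-, hx⟩, rfl⟩ M - h
    have hxU := (hmem x).2 fun i => hx i (Finset.mem_univ i)
    have : x ∈ {y ∈ U | negIndices l Finset.univ y = M} :=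
      Set.ext_iff.1 h x |>.1 ⟨hxU, rfl⟩
    exact this.2
  · rintro _ ⟨x, hx, rfl⟩
    exact ⟨_, ⟨x, ⟨trivial, fun i _ => (hmem x).1 hx i⟩, rfl⟩, (hcomp x hx).symm⟩

theorem ncard_regions {E ι : Type*} [NormedAddCommGroup E] [NormedSpace ℝ E]
    [FiniteDimensional ℝ E] [Fintype ι] (l : ι → E →ᵃ[ℝ] ℝ) :
    (regions (Set.range fun i => (l i).zeroLocus)).ncard =
      (signPatterns l Finset.univ Set.univ).ncard := by
  obtain ⟨f, hf⟩ := exists_bijOn_regions l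
  rw [← hf.image_eq, hf.injOn.ncard_image]

theorem finite_regions {E ι : Type*} [NormedAddCommGroup E] [NormedSpace ℝ E]
    [FiniteDimensional ℝ E] [Fintype ι] (l : ι → E →ᵃ[ℝ] ℝ) :
    (regions (Set.range fun i => (l i).zeroLocus)).Finite := by
  obtain ⟨f, hf⟩ := exists_bijOn_regions l
  rw [← hf.image_eq]
  exact (finite_signPatterns ..).image f

/-! ### Facets and visibility for irredundant polyhedra. -/

/-- The polyhedron cut out by the inequalities `0 ≤ l i x`. -/
def polyhedron {E ι : Type*} [AddCommGroup E] [Module ℝ E] (l : ι → E →ᵃ[ℝ] ℝ) : Set E :=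
  {x | ∀ i, 0 ≤ l i x}

/-- The face of a polyhedron on which the `i`-th inequality is an equality. -/
def polyhedronFace {E ι : Type*} [AddCommGroup E] [Module ℝ E] (l : ι → E →ᵃ[ℝ] ℝ) (i : ι) :
    Set E :=
  {x ∈ polyhedron l | l i x = 0}

/-- A set that contains a point of each ray in `S` from a point of `S` spans `S`. -/
theorem affineSpan_eq_of_exists_lineMap_mem {E : Type*} [AddCommGroup E] [Module ℝ E]
    {S : AffineSubspace ℝ E} {F : Set E} (hF : F ⊆ S) {x : E} (hx : x ∈ F)
    (h : ∀ y ∈ S, ∃ t : ℝ, 0 < t ∧ AffineMap.lineMap x y t ∈ F) : affineSpan ℝ F = S := by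
  refine le_antisymm (affineSpan_le.2 hF) fun y hy => ?_
  obtain ⟨t, ht, hz⟩ := h y hy
  have : AffineMap.lineMap x (AffineMap.lineMap x y t) t⁻¹ = y := by
    rw [AffineMap.lineMap_lineMap_right, inv_mul_cancel₀ ht.ne', AffineMap.lineMap_apply_one]
  rw [← this]
  exact AffineMap.lineMap_mem _ (subset_affineSpan ℝ F hx) (subset_affineSpan ℝ F hz)

/-- From a point of a polyhedron one can move a little in every direction that does not decrease
the functionals vanishing there. -/
theorem exists_lineMap_mem_polyhedron {E ι : Type*} [AddCommGroup E] [Module ℝ E] [Fintype ι]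
    {l : ι → E →ᵃ[ℝ] ℝ} {x y : E} (h : ∀ i, 0 < l i x ∨ l i x = 0 ∧ 0 ≤ l i y) :
    ∃ t : ℝ, 0 < t ∧ t < 1 ∧ AffineMap.lineMap x y t ∈ polyhedron l := by
  obtain ⟨e, he, he'⟩ := Metric.eventually_nhds_iff.1
    (AffineMap.eventually_lineMap_sign l Finset.univ x y)
  have hpos : 0 < min (e / 2) (1 / 2) := by positivity
  refine ⟨min (e / 2) (1 / 2), hpos, (min_le_right _ _).trans_lt (by norm_num), fun i => ?_⟩
  rcases h i with h | ⟨h, h'⟩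
  · refine ((he' ?_ i (Finset.mem_univ i)).1 h).le
    rw [Real.dist_0_eq_abs, abs_of_pos hpos]
    exact (min_le_left _ _).trans_lt (by linarith)
  · rw [AffineMap.apply_lineMap, h, AffineMap.lineMap_apply]
    simpa using mul_nonneg hpos.le h'

theorem affineSpan_polyhedron {E ι : Type*} [AddCommGroup E] [Module ℝ E] [Fintype ι]
    {l : ι → E →ᵃ[ℝ] ℝ} {p : E} (hp : ∀ i, 0 < l i p) : affineSpan ℝ (polyhedron l) = ⊤ := by
  refine affineSpan_eq_of_exists_lineMap_mem (S := ⊤) (fun _ _ => trivial)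
    (x := p) (fun i => (hp i).le) fun y _ => ?_
  obtain ⟨t, ht, -, h⟩ := exists_lineMap_mem_polyhedron (l := l) (y := y) fun i => Or.inl (hp i)
  exact ⟨t, ht, h⟩

theorem mem_polyhedronFace {E ι : Type*} [AddCommGroup E] [Module ℝ E]
    {l : ι → E →ᵃ[ℝ] ℝ} {i : ι} {w : E} (hw : l i w = 0) (hw' : ∀ j ≠ i, 0 < l j w) :
    w ∈ polyhedronFace l i := by
  refine ⟨fun j => ?_, hw⟩
  rcases eq_or_ne j i with rfl | h
  exacts [hw.ge, (hw' j h).le]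

theorem affineSpan_polyhedronFace {E ι : Type*} [AddCommGroup E] [Module ℝ E] [Fintype ι]
    {l : ι → E →ᵃ[ℝ] ℝ} {i : ι} {w : E} (hw : l i w = 0) (hw' : ∀ j ≠ i, 0 < l j w) :
    affineSpan ℝ (polyhedronFace l i) = (l i).zeroLocus := by
  refine affineSpan_eq_of_exists_lineMap_mem (fun x hx => AffineMap.mem_zeroLocus.2 hx.2)
    (mem_polyhedronFace hw hw') fun y hy => ?_
  have hy' := AffineMap.mem_zeroLocus.1 hy
  obtain ⟨t, ht, -, h⟩ := exists_lineMap_mem_polyhedron (l := l) (x := w) (y := y) fun j => by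
    rcases eq_or_ne j i with rfl | h
    exacts [Or.inr ⟨hw, hy'.ge⟩, Or.inl (hw' j h)]
  refine ⟨t, ht, h, ?_⟩
  rw [AffineMap.apply_lineMap, hw, hy']
  simp

theorem AffineMap.finrank_direction_zeroLocus {E : Type*} [AddCommGroup E] [Module ℝ E]
    [FiniteDimensional ℝ E] {f : E →ᵃ[ℝ] ℝ} {x y : E} (hx : f x = 0) (hy : f y ≠ 0) :
    Module.finrank ℝ f.zeroLocus.direction + 1 = Module.finrank ℝ E := by
  have := AffineMap.finrank_direction_inf_zeroLocus (S := ⊤) trivial hx trivial hy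
  rwa [top_inf_eq, AffineSubspace.direction_top, finrank_top] at this

/-- Exposed faces are sets of maximizers, so the functional is the negated linear part of `l i`. The
point `w` ensures that the minimum value `0` of `l i` is attained. -/
theorem isExposed_polyhedronFace {E ι : Type*} [NormedAddCommGroup E] [NormedSpace ℝ E]
    [FiniteDimensional ℝ E] {l : ι → E →ᵃ[ℝ] ℝ} {i : ι} {w : E} (hw : w ∈ polyhedronFace l i) :
    IsExposed ℝ (polyhedron l) (polyhedronFace l i) := by
  intro _
  refine ⟨-LinearMap.toContinuousLinearMap (l i).linear, ?_⟩
  have hlin : ∀ x, (l i).linear x = l i x - l i 0 := fun x => by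
    have := (l i).linearMap_vsub x 0
    simpa using this
  ext x
  refine and_congr_right fun hx => ?_
  simp only [neg_apply, LinearMap.coe_toContinuousLinearMap', hlin, neg_le_neg_iff,
    sub_le_sub_iff_right]
  constructor
  · intro h y hy
    rw [h]
    exact hy i
  · intro h
    exact le_antisymm ((h w hw.1).trans hw.2.le) (hx i)

/-- A convex subset of a polyhedron contained in none of the faces meets the interior. -/
theorem exists_forall_pos_of_convex {E ι : Type*} [AddCommGroup E] [Module ℝ E]
    {l : ι → E →ᵃ[ℝ] ℝ} {F : Set E} (hF : Convex ℝ F) (hFK : F ⊆ polyhedron l)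
    (hne : F.Nonempty) (h : ∀ i, ∃ x ∈ F, l i x ≠ 0) (s : Finset ι) :
    ∃ x ∈ F, ∀ i ∈ s, 0 < l i x := by
  classical
  induction s using Finset.induction_on with
  | empty => exact ⟨hne.some, hne.some_mem, by simp⟩
  | insert a s _ ih =>
    obtain ⟨x, hx, hxs⟩ := ih
    obtain ⟨y, hy, hya⟩ := h a
    refine ⟨midpoint ℝ x y, hF.midpoint_mem hx hy, fun i hi => ?_⟩
    rw [AffineMap.map_midpoint, midpoint_eq_smul_add]
    have h1 := hFK hx i
    have h2 := hFK hy i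
    have h3 : 0 < l i x + l i y := by
      rcases Finset.mem_insert.1 hi with rfl | hi
      · exact add_pos_of_nonneg_of_pos h1 (lt_of_le_of_ne h2 hya.symm)
      · exact add_pos_of_pos_of_nonneg (hxs i hi) h2
    simpa using h3

/-- The facets of a full-dimensional polyhedron given by irredundant inequalities. -/
theorem facets_polyhedron {E ι : Type*} [NormedAddCommGroup E] [NormedSpace ℝ E]
    [FiniteDimensional ℝ E] [Fintype ι] {l : ι → E →ᵃ[ℝ] ℝ} {p : E} (hp : ∀ i, 0 < l i p)
    {w : ι → E} (hw : ∀ i, l i (w i) = 0) (hw' : ∀ i, ∀ j ≠ i, 0 < l j (w i)) :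
    facets (polyhedron l) = Set.range (polyhedronFace l) := by
  have hdim : ∀ i, Module.finrank ℝ (l i).zeroLocus.direction + 1 = Module.finrank ℝ E :=
    fun i => AffineMap.finrank_direction_zeroLocus (hw i) (hp i).ne'
  have hK : Module.finrank ℝ (affineSpan ℝ (polyhedron l)).direction = Module.finrank ℝ E := by
    rw [affineSpan_polyhedron hp, AffineSubspace.direction_top, finrank_top]
  have hconv : Convex ℝ (polyhedron l) := by
    have : polyhedron l = ⋂ i, l i ⁻¹' Set.Ici 0 := by
      ext x
      simp [polyhedron]
    rw [this]
    exact convex_iInter fun i => (convex_Ici 0).affine_preimage (l i)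
  ext F
  constructor
  · rintro ⟨hexp, hne, hF⟩
    rw [hK] at hF
    obtain ⟨g, hg⟩ := hexp hne
    have hFK : F ⊆ polyhedron l := hexp.subset
    -- Otherwise `F` contains an interior point `x`. A linear functional maximized there is constant
    -- on the polyhedron, so `F` is everything and has the wrong dimension.
    obtain ⟨i, hi⟩ : ∃ i, ∀ x ∈ F, l i x = 0 := by
      by_contra! hcon
      obtain ⟨x, hx, hpos⟩ := exists_forall_pos_of_convex (hexp.convex hconv) hFK hne hcon
        Finset.univ
      have hconst : ∀ y ∈ polyhedron l, g x ≤ g y := by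
        intro y hy
        -- The target is the reflection of `y` in `x`: a small step from `x` away from `y` stays
        -- inside and cannot increase `g`.
        obtain ⟨t, ht, -, hz⟩ := exists_lineMap_mem_polyhedron (l := l)
          (y := x + (x - y)) fun i => Or.inl (hpos i (Finset.mem_univ i))
        rw [hg] at hx
        have := hx.2 _ hz
        simp only [AffineMap.lineMap_apply, vsub_eq_sub, add_sub_cancel_left, vadd_eq_add,
          map_add, map_smul, map_sub, smul_eq_mul] at this
        have : t * (g x - g y) ≤ 0 := by linarith
        nlinarith
      have hFeq : F = polyhedron l := by
        refine hFK.antisymm fun y hy => ?_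
        rw [hg] at hx ⊢
        exact ⟨hy, fun z hz => (hx.2 z hz).trans (hconst y hy)⟩
      rw [hFeq, hK] at hF
      omega
    refine ⟨i, ?_⟩
    have hle : affineSpan ℝ F ≤ (l i).zeroLocus :=
      affineSpan_le.2 fun x hx => AffineMap.mem_zeroLocus.2 (hi x hx)
    -- Equal dimensions make `F` span the hyperplane, so `g` is constant on it and every point of
    -- the `i`-th face is a maximizer.
    have hspan : affineSpan ℝ F = (l i).zeroLocus := by
      refine AffineSubspace.eq_of_direction_eq_of_nonempty_of_le ?_ (hne.affineSpan ℝ) hle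
      refine Submodule.eq_of_le_of_finrank_eq (AffineSubspace.direction_le hle) ?_
      have := hdim i
      omega
    obtain ⟨x₀, hx₀⟩ := hne
    have hgF : ∀ x ∈ affineSpan ℝ F, g x = g x₀ := by
      intro x hx
      refine affineSpan_induction (p := fun x => g x = g x₀) hx ?_ ?_
      · intro y hy
        rw [hg] at hy hx₀
        exact le_antisymm (hx₀.2 y hy.1) (hy.2 x₀ hx₀.1)
      · intro c u v z hu hv hz
        simp only [vsub_eq_sub, vadd_eq_add, map_add, map_smul, map_sub, hu, hv, hz]
        simp
    refine Set.Subset.antisymm (fun x hx => ?_) fun x hx => ⟨hFK hx, hi x hx⟩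
    have hx' := hgF x (hspan ▸ AffineMap.mem_zeroLocus.2 hx.2)
    rw [hg] at hx₀ ⊢
    exact ⟨hx.1, fun y hy => (hx₀.2 y hy).trans hx'.ge⟩
  · rintro ⟨i, rfl⟩
    have hmem := mem_polyhedronFace (hw i) (hw' i)
    refine ⟨isExposed_polyhedronFace hmem, ⟨_, hmem⟩, ?_⟩
    rw [affineSpan_polyhedronFace (hw i) (hw' i), hK]
    exact hdim i

theorem visibilityArrangement_polyhedron {E ι : Type*} [NormedAddCommGroup E] [NormedSpace ℝ E]
    [FiniteDimensional ℝ E] [Fintype ι] {l : ι → E →ᵃ[ℝ] ℝ} {p : E} (hp : ∀ i, 0 < l i p)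
    {w : ι → E} (hw : ∀ i, l i (w i) = 0) (hw' : ∀ i, ∀ j ≠ i, 0 < l j (w i)) :
    visibilityArrangement (polyhedron l) = Set.range fun i => (l i).zeroLocus := by
  rw [visibilityArrangement, facets_polyhedron hp hw hw', ← Set.range_comp]
  congr 1
  funext i
  exact affineSpan_polyhedronFace (hw i) (hw' i)

/-- A facet is visible from exactly the points strictly beyond it. -/
theorem visibleFacets_polyhedron {E ι : Type*} [NormedAddCommGroup E] [NormedSpace ℝ E]
    [FiniteDimensional ℝ E] [Fintype ι] {l : ι → E →ᵃ[ℝ] ℝ} {p : E} (hp : ∀ i, 0 < l i p)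
    {w : ι → E} (hw : ∀ i, l i (w i) = 0) (hw' : ∀ i, ∀ j ≠ i, 0 < l j (w i)) (x : E) :
    visibleFacets (polyhedron l) x = polyhedronFace l '' negIndices l Finset.univ x := by
  ext F
  constructor
  · rintro ⟨hF, hx, hvis⟩
    rw [facets_polyhedron hp hw hw'] at hF
    obtain ⟨i, rfl⟩ := hF
    refine ⟨i, mem_negIndices.2 ⟨Finset.mem_univ i, ?_⟩, rfl⟩
    by_contra hneg
    have hwi := mem_polyhedronFace (hw i) (hw' i)
    have hne : w i ≠ x := fun h => hx (h ▸ hwi.1)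
    -- If `l i x` is nonnegative, the segment from `w i` to `x` starts inside the polyhedron and
    -- blocks the view of `w i`.
    obtain ⟨t, ht, ht1, hz⟩ := exists_lineMap_mem_polyhedron (l := l) (x := w i) (y := x)
      fun j => by
        rcases eq_or_ne j i with rfl | h
        exacts [Or.inr ⟨hw j, not_lt.1 hneg⟩, Or.inl (hw' i j h)]
    exact hvis _ hwi hz (sbtw_comm.1 (sbtw_lineMap_iff.2 ⟨hne, ht, ht1⟩))
  · rintro ⟨i, hi, rfl⟩
    have hxi := (mem_negIndices.1 hi).2
    refine ⟨?_, fun hx => (hx i).not_gt hxi, fun y hy z hz hs => ?_⟩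
    · rw [facets_polyhedron hp hw hw']
      exact ⟨i, rfl⟩
    · obtain ⟨⟨t, ⟨ht0, ht1⟩, rfl⟩, -, hne⟩ := hs
      have ht : t < 1 := lt_of_le_of_ne ht1 fun h => hne (by rw [h, AffineMap.lineMap_apply_one])
      have := hz i
      rw [AffineMap.apply_lineMap, hy.2, AffineMap.lineMap_apply] at this
      simp only [vsub_eq_sub, zero_sub, smul_eq_mul, vadd_eq_add] at this
      nlinarith

theorem polyhedronFace_injective {E ι : Type*} [AddCommGroup E] [Module ℝ E]
    {l : ι → E →ᵃ[ℝ] ℝ} {w : ι → E} (hw : ∀ i, l i (w i) = 0)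
    (hw' : ∀ i, ∀ j ≠ i, 0 < l j (w i)) : Function.Injective (polyhedronFace l) := by
  intro i j h
  by_contra hij
  have hmem := mem_polyhedronFace (hw i) (hw' i)
  rw [h] at hmem
  exact (hw' i j (Ne.symm hij)).ne' hmem.2

/-- The visibility sets of facets are counted by the realized sign patterns. -/
theorem ncard_visibilitySets_polyhedron {E ι : Type*} [NormedAddCommGroup E] [NormedSpace ℝ E]
    [FiniteDimensional ℝ E] [Fintype ι] {l : ι → E →ᵃ[ℝ] ℝ} {p : E} (hp : ∀ i, 0 < l i p)
    {w : ι → E} (hw : ∀ i, l i (w i) = 0) (hw' : ∀ i, ∀ j ≠ i, 0 < l j (w i)) :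
    (visibilitySets (polyhedron l)).ncard =
      (signPatterns l Finset.univ Set.univ).ncard := by
  have himage : visibilitySets (polyhedron l) =
      (fun N : Finset ι => polyhedronFace l '' N) '' signPatterns l Finset.univ Set.univ := by
    apply Set.Subset.antisymm
    · rintro _ ⟨x, rfl⟩
      rw [visibleFacets_polyhedron hp hw hw']
      -- A small push towards the interior point `p` makes vanishing functionals positive and keeps
      -- negative ones negative. Thus points on the hyperplanes yield no new visibility sets.
      obtain ⟨e, he, he'⟩ := Metric.eventually_nhds_iff.1
        (AffineMap.eventually_lineMap_sign l Finset.univ x p)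
      have hpos : 0 < min (e / 2) (1 / 2) := by positivity
      set t := min (e / 2) (1 / 2) with ht
      have hte : dist t 0 < e := by
        rw [Real.dist_0_eq_abs, abs_of_pos hpos]
        exact (min_le_left _ _).trans_lt (by linarith)
      have ht1 : t < 1 := (min_le_right _ _).trans_lt (by norm_num)
      have hnn : ∀ i, 0 ≤ l i x → 0 < l i (AffineMap.lineMap x p t) := by
        intro i hi
        rw [AffineMap.apply_lineMap, AffineMap.lineMap_apply]
        simp only [vsub_eq_sub, smul_eq_mul, vadd_eq_add]
        nlinarith [mul_pos hpos (hp i), mul_nonneg (sub_pos.2 ht1).le hi]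
      have hlt : ∀ i, l i x < 0 → l i (AffineMap.lineMap x p t) < 0 := fun i =>
        (he' hte i (Finset.mem_univ i)).2
      refine ⟨_, ⟨AffineMap.lineMap x p t, ⟨trivial, fun i _ => ?_⟩, rfl⟩, ?_⟩
      · rcases lt_or_ge (l i x) 0 with h | h
        exacts [(hlt i h).ne, (hnn i h).ne']
      · have : negIndices l Finset.univ (AffineMap.lineMap x p t) =
            negIndices l Finset.univ x := by
          refine negIndices_eq_iff.2 fun i _ => ⟨fun h => ?_, hlt i⟩
          by_contra h'
          exact (hnn i (not_lt.1 h')).not_gt h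
        exact congrArg (fun N : Finset ι => polyhedronFace l '' N) this
    · rintro _ ⟨_, ⟨x, -, rfl⟩, rfl⟩
      exact ⟨x, visibleFacets_polyhedron hp hw hw' x⟩
  rw [himage, Set.InjOn.ncard_image]
  intro N _ M _ h
  exact Finset.coe_injective ((polyhedronFace_injective hw hw').image_injective h)

/-! ### The finite field method for coordinate equations. -/

/-- Assignments compatible with a relation and with prescribed boundary values are free on the
classes that do not contain a boundary element. -/
noncomputable def compatibleEquiv {V D β : Type*} (r : V ⊕ β → V ⊕ β → Prop) (k : β → D)
    (h : Function.Injective fun b => Quot.mk r (Sum.inr b)) :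
    {x : V → D // ∀ a b, r a b → Sum.elim x k a = Sum.elim x k b} ≃
      ({c : Quot r // ¬ ∃ b, c = Quot.mk r (Sum.inr b)} → D) :=
  open Classical in
  let z : ({c : Quot r // ¬ ∃ b, c = Quot.mk r (Sum.inr b)} → D) → Quot r → D := fun y c =>
    if hc : ∃ b, c = Quot.mk r (Sum.inr b) then k hc.choose else y ⟨c, hc⟩
  have hz : ∀ y a, Sum.elim (fun v => z y (Quot.mk r (Sum.inl v))) k a = z y (Quot.mk r a) := by
    rintro y (v | b)
    · rfl
    · have hb : ∃ b', Quot.mk r (Sum.inr b) = Quot.mk r (Sum.inr b') := ⟨b, rfl⟩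
      have : hb.choose = b := (h hb.choose_spec).symm
      simp only [z, dif_pos hb, this, Sum.elim_inr]
  { toFun := fun x c => Quot.lift (Sum.elim x.1 k) x.2 c.1
    invFun := fun y => ⟨fun v => z y (Quot.mk r (Sum.inl v)), fun a b hab => by
      rw [hz, hz, Quot.sound hab]⟩
    left_inv := by
      rintro ⟨x, hx⟩
      refine Subtype.ext (funext fun v => ?_)
      simp only [z]
      split_ifs with hc
      · have : Quot.lift (Sum.elim x k) hx (Quot.mk r (Sum.inl v)) =
            Quot.lift (Sum.elim x k) hx (Quot.mk r (Sum.inr hc.choose)) :=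
          congrArg _ hc.choose_spec
        exact this.symm
      · rfl
    right_inv := by
      intro y
      funext ⟨c, hc⟩
      induction c using Quot.ind with
      | mk a =>
        change Sum.elim (fun v => z y (Quot.mk r (Sum.inl v))) k a = _
        rw [hz]
        exact dif_neg hc }

/-- The real assignments compatible with a relation and with prescribed boundary values form an
affine subspace whose dimension is the number of classes without a boundary element. -/
theorem finrank_direction_of_compatible {V β : Type*} [Finite V] [Finite β]
    (r : V ⊕ β → V ⊕ β → Prop) (k : β → ℝ)
    (h : Function.Injective fun b => Quot.mk r (Sum.inr b)) {S : AffineSubspace ℝ (V → ℝ)}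
    (hS : ∀ x, x ∈ S ↔ ∀ a b, r a b → Sum.elim x k a = Sum.elim x k b)
    (hne : (S : Set (V → ℝ)).Nonempty) :
    Module.finrank ℝ S.direction =
      Nat.card {c : Quot r // ¬ ∃ b, c = Quot.mk r (Sum.inr b)} := by
  classical
  obtain ⟨p, hp⟩ := hne
  have hadd : ∀ v w : V → ℝ, ∀ k' : β → ℝ, ∀ a,
      Sum.elim (v + w) k' a = Sum.elim v (0 : β → ℝ) a + Sum.elim w k' a := by
    rintro v w k' (a | a) <;> simp
  -- The direction is the solution space of the same equations with all boundary values replaced by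
  -- `0`.
  have hdir : ∀ v, v ∈ S.direction ↔
      ∀ a b, r a b → Sum.elim v (0 : β → ℝ) a = Sum.elim v (0 : β → ℝ) b := by
    intro v
    rw [← AffineSubspace.vadd_mem_iff_mem_direction v hp, hS]
    refine forall_congr' fun a => forall_congr' fun b => forall_congr' fun hab => ?_
    rw [vadd_eq_add, hadd, hadd, (hS p).1 hp a b hab, add_left_inj]
  let Φ := compatibleEquiv r (0 : β → ℝ) h
  let f : S.direction →ₗ[ℝ] ({c : Quot r // ¬ ∃ b, c = Quot.mk r (Sum.inr b)} → ℝ) :=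
    { toFun := fun v => Φ ⟨v.1, (hdir v.1).1 v.2⟩
      map_add' := by
        rintro v w
        funext ⟨c, hc⟩
        induction c using Quot.ind with
        | mk a => exact hadd v.1 w.1 0 a
      map_smul' := by
        rintro t v
        funext ⟨c, hc⟩
        induction c using Quot.ind with
        | mk a =>
          change Sum.elim (t • v.1) (0 : β → ℝ) a = t * Sum.elim v.1 (0 : β → ℝ) a
          rcases a with a | a <;> simp }
  have hf : Function.Bijective f := by
    constructor
    · intro v w hvw
      have := Φ.injective hvw
      exact Subtype.ext (Subtype.mk.inj this)
    · intro y
      refine ⟨⟨(Φ.symm y).1, (hdir _).2 (Φ.symm y).2⟩, ?_⟩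
      exact Φ.apply_symm_apply y
  have := Fintype.ofFinite {c : Quot r // ¬ ∃ b, c = Quot.mk r (Sum.inr b)}
  rw [(LinearEquiv.ofBijective f hf).finrank_eq, Module.finrank_fintype_fun_eq_card,
    Nat.card_eq_fintype_card]

/-- For a subspace cut out by equations between coordinates and boundary values, the number of
its points over a finite set of values is a power of the size of that set. -/
theorem card_compatible {V β D : Type*} [Finite V] [Finite β] [Finite D]
    (r : V ⊕ β → V ⊕ β → Prop) {k : β → ℝ} (hk : Function.Injective k) {k' : β → D}
    (hk' : Function.Injective k') {S : AffineSubspace ℝ (V → ℝ)}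
    (hS : ∀ x, x ∈ S ↔ ∀ a b, r a b → Sum.elim x k a = Sum.elim x k b)
    [Decidable (S : Set (V → ℝ)).Nonempty] :
    Nat.card {x : V → D // ∀ a b, r a b → Sum.elim x k' a = Sum.elim x k' b} =
      if (S : Set (V → ℝ)).Nonempty then Nat.card D ^ Module.finrank ℝ S.direction else 0 := by
  by_cases h : Function.Injective fun b => Quot.mk r (Sum.inr b)
  · have hne : (S : Set (V → ℝ)).Nonempty :=
      ⟨_, (hS _).2 ((compatibleEquiv r k h).symm 0).2⟩
    rw [if_pos hne, finrank_direction_of_compatible r k h hS hne,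
      Nat.card_congr (compatibleEquiv r k' h), Nat.card_fun]
  -- Two boundary elements in one class would force distinct values to agree, so there are no
  -- solutions over the reals or over `D`.
  · have hne : ¬ (S : Set (V → ℝ)).Nonempty := by
      rintro ⟨x, hx⟩
      refine h fun b b' hb => hk ?_
      exact congrArg (Quot.lift (Sum.elim x k) ((hS x).1 hx)) hb
    rw [if_neg hne]
    have : IsEmpty {x : V → D // ∀ a b, r a b → Sum.elim x k' a = Sum.elim x k' b} := by
      refine ⟨fun x => h fun b b' hb => hk' ?_⟩
      exact congrArg (Quot.lift (Sum.elim x.1 k') x.2) hb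
    exact Nat.card_of_isEmpty

/-- The finite field method for arrangements of hyperplanes given by equations between coordinates
and boundary values. -/
theorem eval_whitneyPolynomial_card {V β D ι : Type*} [Finite V] [Finite β] [Finite D]
    [Fintype ι] (e : ι → (V ⊕ β) × (V ⊕ β)) {k : β → ℝ} (hk : Function.Injective k) {k' : β → D}
    (hk' : Function.Injective k') (H : ι → AffineSubspace ℝ (V → ℝ))
    (hH : ∀ i x, x ∈ H i ↔ Sum.elim x k (e i).1 = Sum.elim x k (e i).2) :
    (whitneyPolynomial H Finset.univ ⊤).eval (Nat.card D : ℤ) =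
      (Nat.card {x : V → D // ∀ i, Sum.elim x k' (e i).1 ≠ Sum.elim x k' (e i).2} : ℤ) := by
  classical
  have := Fintype.ofFinite V
  have := Fintype.ofFinite D
  let Z : ι → Finset (V → D) := fun i =>
    Finset.univ.filter fun x => Sum.elim x k' (e i).1 = Sum.elim x k' (e i).2
  have hmemZ : ∀ (B : Finset ι) (x : V → D), x ∈ B.inf Z ↔
      ∀ a b, (∃ i ∈ B, e i = (a, b)) → Sum.elim x k' a = Sum.elim x k' b := by
    intro B x
    rw [Finset.mem_inf]
    constructor
    · rintro h a b ⟨i, hi, hab⟩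
      have := (Finset.mem_filter.1 (h i hi)).2
      rwa [hab] at this
    · intro h i hi
      exact Finset.mem_filter.2 ⟨Finset.mem_univ x, h _ _ ⟨i, hi, rfl⟩⟩
  have hcard : ∀ B : Finset ι, (B.inf Z).card =
      if ((B.inf H : AffineSubspace ℝ (V → ℝ)) : Set (V → ℝ)).Nonempty then
        Nat.card D ^ Module.finrank ℝ (B.inf H).direction else 0 := by
    intro B
    rw [← card_compatible (fun a b => ∃ i ∈ B, e i = (a, b)) hk hk' (S := B.inf H),
      Nat.subtype_card (B.inf Z) (hmemZ B)]
    intro x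
    rw [AffineSubspace.mem_finsetInf]
    constructor
    · rintro h a b ⟨i, hi, hab⟩
      have := (hH i x).1 (h i hi)
      rwa [hab] at this
    · intro h i hi
      exact (hH i x).2 (h _ _ ⟨i, hi, rfl⟩)
  -- Inclusion-exclusion for the maps that avoid all equations matches the Whitney sum term by term.
  have hmain := Finset.inclusion_exclusion_card_inf_compl Finset.univ Z
  rw [← Nat.subtype_card (Finset.univ.inf fun i => (Z i)ᶜ)
    (p := fun x => ∀ i, Sum.elim x k' (e i).1 ≠ Sum.elim x k' (e i).2)] at hmain
  · rw [hmain, whitneyPolynomial, Polynomial.eval_finsetSum]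
    refine Finset.sum_congr rfl fun B _ => ?_
    rw [hcard, top_inf_eq]
    split_ifs <;> simp
  · intro x
    simp [Finset.mem_inf, Z]

/-! ### Rank-one posets and the inequalities of their order polytopes. -/

/-- An element below `a` would give a chain of three elements, and hence a maximal chain with at
least three. -/
theorem IsGradedOfRankOne.isMin_and_not_isMin_of_lt {P : Type*} [PartialOrder P] [Finite P]
    (hP : IsGradedOfRankOne P) {a b : P} (hab : a < b) : IsMin a ∧ ¬ IsMin b := by
  refine ⟨fun c hca => ?_, fun h => hab.not_ge (h hab.le)⟩
  by_contra hac
  have hca : c < a := lt_of_le_not_ge hca hac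
  have hch : IsChain (· ≤ ·) ({c, a, b} : Set P) := by
    refine IsChain.insert (IsChain.insert (IsChain.singleton) ?_) ?_
    · rintro x rfl -
      exact Or.inl hab.le
    · rintro x (rfl | rfl) -
      exacts [Or.inl hca.le, Or.inl (hca.trans hab).le]
  obtain ⟨M, hM, hsub⟩ := hch.exists_maxChain
  have h2 := Set.ncard_le_ncard hsub (Set.toFinite M)
  rw [hP M hM, Set.ncard_eq_three.2 ⟨c, a, b, hca.ne, (hca.trans hab).ne, hab.ne, rfl⟩] at h2
  omega

theorem IsGradedOfRankOne.exists_lt_or_gt {P : Type*} [PartialOrder P] [Finite P]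
    (hP : IsGradedOfRankOne P) (v : P) : ∃ u, u < v ∨ v < u := by
  obtain ⟨M, hM, hsub⟩ := (IsChain.singleton (r := (· ≤ ·)) (a := v)).exists_maxChain
  have hv : v ∈ M := hsub rfl
  obtain ⟨u, hu, huv⟩ := Set.exists_ne_of_one_lt_ncard (s := M) (by rw [hP M hM]; omega) v
  refine ⟨u, ?_⟩
  rcases hM.1 hu hv huv with h | h
  exacts [Or.inl (lt_of_le_of_ne h huv), Or.inr (lt_of_le_of_ne h huv.symm)]

theorem IsGradedOfRankOne.hasse_adj {P : Type*} [PartialOrder P] [Finite P]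
    (hP : IsGradedOfRankOne P) {a b : P} : (SimpleGraph.hasse P).Adj a b ↔ a < b ∨ b < a := by
  have hcov : ∀ {a b : P}, a ⋖ b ↔ a < b := fun {a b} => ⟨CovBy.lt, fun h => ⟨h, fun c hac hcb =>
    (hP.isMin_and_not_isMin_of_lt hac).2 (hP.isMin_and_not_isMin_of_lt hcb).1⟩⟩
  rw [SimpleGraph.hasse_adj, hcov, hcov]

/-- The inequalities of the order polytope of a poset of rank one: one for each comparable pair,
and one for each element. -/
abbrev OrderPolytopeIndex (P : Type*) [PartialOrder P] : Type _ :=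
  {c : P × P // c.1 < c.2} ⊕ P

open Classical in
/-- The affine functionals that are nonnegative on the order polytope of a poset of rank one. -/
noncomputable def orderPolytopeFunctional {P : Type*} [PartialOrder P] :
    OrderPolytopeIndex P → (P → ℝ) →ᵃ[ℝ] ℝ
  | Sum.inl c => ((LinearMap.proj c.1.2 : (P → ℝ) →ₗ[ℝ] ℝ) -
      (LinearMap.proj c.1.1 : (P → ℝ) →ₗ[ℝ] ℝ)).toAffineMap
  | Sum.inr v => if IsMin v then (LinearMap.proj v : (P → ℝ) →ₗ[ℝ] ℝ).toAffineMap else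
      AffineMap.const ℝ (P → ℝ) 1 - (LinearMap.proj v : (P → ℝ) →ₗ[ℝ] ℝ).toAffineMap

open Classical in
/-- The two coordinates or boundary values that agree where the functional of the given index
vanishes; the boundary values `0` and `1` are represented by booleans. -/
noncomputable def orderPolytopeEquation {P : Type*} [PartialOrder P] :
    OrderPolytopeIndex P → (P ⊕ Bool) × (P ⊕ Bool)
  | Sum.inl c => (Sum.inl c.1.1, Sum.inl c.1.2)
  | Sum.inr v => (Sum.inl v, Sum.inr (decide (¬ IsMin v)))

theorem orderPolytopeFunctional_inl {P : Type*} [PartialOrder P] (c : {c : P × P // c.1 < c.2})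
    (x : P → ℝ) : orderPolytopeFunctional (Sum.inl c) x = x c.1.2 - x c.1.1 := by
  simp [orderPolytopeFunctional]

theorem orderPolytopeFunctional_inr_of_isMin {P : Type*} [PartialOrder P] {v : P} (hv : IsMin v)
    (x : P → ℝ) : orderPolytopeFunctional (Sum.inr v) x = x v := by
  simp [orderPolytopeFunctional, hv]

theorem orderPolytopeFunctional_inr_of_not_isMin {P : Type*} [PartialOrder P] {v : P}
    (hv : ¬ IsMin v) (x : P → ℝ) : orderPolytopeFunctional (Sum.inr v) x = 1 - x v := by
  simp [orderPolytopeFunctional, hv]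

theorem mem_zeroLocus_orderPolytopeFunctional {P : Type*} [PartialOrder P]
    (i : OrderPolytopeIndex P) (x : P → ℝ) :
    x ∈ (orderPolytopeFunctional i).zeroLocus ↔
      Sum.elim x (fun b : Bool => if b then (1 : ℝ) else 0) (orderPolytopeEquation i).1 =
        Sum.elim x (fun b : Bool => if b then (1 : ℝ) else 0) (orderPolytopeEquation i).2 := by
  rw [AffineMap.mem_zeroLocus]
  rcases i with c | v
  · rw [orderPolytopeFunctional_inl, sub_eq_zero, eq_comm]
    rfl
  · by_cases hv : IsMin v
    · simp [orderPolytopeFunctional_inr_of_isMin hv, orderPolytopeEquation, hv]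
    · rw [orderPolytopeFunctional_inr_of_not_isMin hv, sub_eq_zero, eq_comm]
      simp [orderPolytopeEquation, hv]

/-- The bounds not listed follow from a comparable element: a minimal `v` lies below some `u`, so `x
v ≤ x u ≤ 1`, and dually. Such a `u` exists because no element is isolated. -/
theorem IsGradedOfRankOne.polyhedron_eq_orderPolytope {P : Type*} [PartialOrder P] [Finite P]
    (hP : IsGradedOfRankOne P) :
    polyhedron (orderPolytopeFunctional (P := P)) = orderPolytope P := by
  ext x
  constructor
  · intro h
    have hlt : ∀ a b, a < b → x a ≤ x b := fun a b hab => by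
      have := h (Sum.inl ⟨(a, b), hab⟩)
      rw [orderPolytopeFunctional_inl] at this
      linarith
    have hmin : ∀ v, IsMin v → 0 ≤ x v := fun v hv => by
      have := h (Sum.inr v)
      rwa [orderPolytopeFunctional_inr_of_isMin hv] at this
    have hmax : ∀ v, ¬ IsMin v → x v ≤ 1 := fun v hv => by
      have := h (Sum.inr v)
      rw [orderPolytopeFunctional_inr_of_not_isMin hv] at this
      linarith
    refine ⟨fun a b hab => ?_, fun v => ?_⟩
    · rcases eq_or_lt_of_le hab with rfl | hab
      exacts [le_rfl, hlt a b hab]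
    · obtain ⟨u, hu | hu⟩ := hP.exists_lt_or_gt v
      · have := hP.isMin_and_not_isMin_of_lt hu
        exact ⟨(hmin u this.1).trans (hlt u v hu), hmax v this.2⟩
      · have := hP.isMin_and_not_isMin_of_lt hu
        exact ⟨hmin v this.1, (hlt v u hu).trans (hmax u this.2)⟩
  · rintro ⟨hmono, hx⟩ (c | v)
    · rw [orderPolytopeFunctional_inl]
      exact sub_nonneg.2 (hmono c.2.le)
    · by_cases hv : IsMin v
      · rw [orderPolytopeFunctional_inr_of_isMin hv]
        exact (hx v).1
      · rw [orderPolytopeFunctional_inr_of_not_isMin hv]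
        exact sub_nonneg.2 (hx v).2

open Classical in
/-- A point in the interior of the order polytope of a poset of rank one. -/
noncomputable def orderPolytopeCenter (P : Type*) [PartialOrder P] (v : P) : ℝ :=
  if IsMin v then 1 / 3 else 2 / 3

open Classical in
/-- A point in the relative interior of a facet of the order polytope of a poset of rank one. -/
noncomputable def orderPolytopeFacetPoint {P : Type*} [PartialOrder P] :
    OrderPolytopeIndex P → P → ℝ
  | Sum.inl c => fun v => if v = c.1.1 ∨ v = c.1.2 then 1 / 2 else orderPolytopeCenter P v
  | Sum.inr u => fun v => if v = u then (if IsMin v then 0 else 1) else orderPolytopeCenter P v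

theorem IsGradedOfRankOne.orderPolytopeFunctional_center_pos {P : Type*} [PartialOrder P]
    [Finite P] (hP : IsGradedOfRankOne P) (i : OrderPolytopeIndex P) :
    0 < orderPolytopeFunctional i (orderPolytopeCenter P) := by
  rcases i with c | v
  · have := hP.isMin_and_not_isMin_of_lt c.2
    rw [orderPolytopeFunctional_inl, orderPolytopeCenter, orderPolytopeCenter, if_pos this.1,
      if_neg this.2]
    norm_num
  · by_cases hv : IsMin v
    · rw [orderPolytopeFunctional_inr_of_isMin hv, orderPolytopeCenter, if_pos hv]
      norm_num
    · rw [orderPolytopeFunctional_inr_of_not_isMin hv, orderPolytopeCenter, if_neg hv]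
      norm_num

theorem orderPolytopeFunctional_facetPoint {P : Type*} [PartialOrder P]
    (i : OrderPolytopeIndex P) :
    orderPolytopeFunctional i (orderPolytopeFacetPoint i) = 0 := by
  rcases i with c | v
  · rw [orderPolytopeFunctional_inl]
    simp [orderPolytopeFacetPoint]
  · by_cases hv : IsMin v
    · rw [orderPolytopeFunctional_inr_of_isMin hv]
      simp [orderPolytopeFacetPoint, hv]
    · rw [orderPolytopeFunctional_inr_of_not_isMin hv]
      simp [orderPolytopeFacetPoint, hv]

/-- This is irredundancy. Since `1/2` lies strictly between the central values `1/3` and `2/3`,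
equalizing one pair keeps all other inequalities strict; moving a single coordinate to its own bound
only widens the gaps to its neighbors. -/
theorem IsGradedOfRankOne.orderPolytopeFunctional_facetPoint_pos {P : Type*} [PartialOrder P]
    [Finite P] (hP : IsGradedOfRankOne P) (i j : OrderPolytopeIndex P) (hij : j ≠ i) :
    0 < orderPolytopeFunctional j (orderPolytopeFacetPoint i) := by
  rcases i with ⟨⟨a, b⟩, hab⟩ | u
  · have hi : IsMin a ∧ ¬ IsMin b := hP.isMin_and_not_isMin_of_lt hab
    rcases j with ⟨⟨c, d⟩, hcd⟩ | v
    · have hj : IsMin c ∧ ¬ IsMin d := hP.isMin_and_not_isMin_of_lt hcd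
      have hne : ¬ (c = a ∧ d = b) := fun h => hij (by simp [h.1, h.2])
      have hcb : c ≠ b := fun h => hi.2 (h ▸ hj.1)
      have hda : d ≠ a := fun h => hj.2 (h ▸ hi.1)
      rw [orderPolytopeFunctional_inl]
      simp only [orderPolytopeFacetPoint, orderPolytopeCenter, hj.1, hj.2, hcb, hda, or_false,
        false_or, if_true, if_false]
      split_ifs <;> first | (norm_num; done) | (exfalso; tauto)
    · by_cases hv : IsMin v
      · rw [orderPolytopeFunctional_inr_of_isMin hv]
        simp only [orderPolytopeFacetPoint, orderPolytopeCenter, hv]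
        split_ifs <;> norm_num
      · rw [orderPolytopeFunctional_inr_of_not_isMin hv]
        simp only [orderPolytopeFacetPoint, orderPolytopeCenter, hv]
        split_ifs <;> norm_num
  · rcases j with ⟨⟨c, d⟩, hcd⟩ | v
    · have hj : IsMin c ∧ ¬ IsMin d := hP.isMin_and_not_isMin_of_lt hcd
      rw [orderPolytopeFunctional_inl]
      simp only [orderPolytopeFacetPoint, orderPolytopeCenter, hj.1, hj.2, if_true, if_false]
      split_ifs <;> norm_num
    · have hne : v ≠ u := fun h => hij (by rw [h])
      by_cases hv : IsMin v
      · rw [orderPolytopeFunctional_inr_of_isMin hv]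
        simp only [orderPolytopeFacetPoint, orderPolytopeCenter, hv, hne]
        norm_num
      · rw [orderPolytopeFunctional_inr_of_not_isMin hv]
        simp only [orderPolytopeFacetPoint, orderPolytopeCenter, hv, hne]
        norm_num

/-! ### From avoiding maps to chromatic polynomials. -/

/-- Colorings with two special colors that avoid the equations of the order polytope are, on the
elements without special color, proper colorings of the Hasse diagram. -/
theorem IsGradedOfRankOne.card_avoiding {P : Type*} [PartialOrder P] [Fintype P]
    (hP : IsGradedOfRankOne P) (q : ℕ) :
    Nat.card {x : P → Fin q ⊕ Bool // ∀ i, Sum.elim x Sum.inr (orderPolytopeEquation i).1 ≠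
      Sum.elim x Sum.inr (orderPolytopeEquation i).2} =
    ∑ W : Finset P,
      Nat.card (((SimpleGraph.hasse P).induce (W : Set P)).Coloring (Fin q)) := by
  classical
  have hiff : ∀ x : P → Fin q ⊕ Bool, (∀ i, Sum.elim x Sum.inr (orderPolytopeEquation i).1 ≠
      Sum.elim x Sum.inr (orderPolytopeEquation i).2) ↔
      (∀ a b, a < b → x a ≠ x b) ∧ ∀ v, x v ≠ Sum.inr (decide (¬ IsMin v)) := by
    intro x
    rw [Sum.forall]
    refine and_congr ⟨fun h a b hab => h ⟨(a, b), hab⟩, fun h c => h _ _ c.2⟩ Iff.rfl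
  set A : Finset (P → Fin q ⊕ Bool) := Finset.univ.filter fun x =>
    (∀ a b, a < b → x a ≠ x b) ∧ ∀ v, x v ≠ Sum.inr (decide (¬ IsMin v)) with hA
  rw [Nat.subtype_card A fun x => by rw [hiff, hA]; simp]
  -- The maps are sorted by the set `W` of elements with an ordinary color.
  rw [Finset.card_eq_sum_card_fiberwise (f := fun x => Finset.univ.filter fun v => (x v).isLeft)
    (t := Finset.univ) fun _ _ => Finset.mem_coe.2 (Finset.mem_univ _)]
  refine Finset.sum_congr rfl fun W _ => ?_
  -- Outside `W` the color is forced to be the special color not forbidden at `v`: `true` for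
  -- minimal elements, `false` for the others. Comparable elements therefore never share a special
  -- color.
  let g₀ : ((SimpleGraph.hasse P).induce (W : Set P)).Coloring (Fin q) → P → Fin q ⊕ Bool :=
    fun c v => if h : v ∈ W then Sum.inl (c ⟨v, h⟩) else Sum.inr (decide (IsMin v))
  have hin : ∀ c v (h : v ∈ W), g₀ c v = Sum.inl (c ⟨v, h⟩) := fun c v h => dif_pos h
  have hout : ∀ c v, v ∉ W → g₀ c v = Sum.inr (decide (IsMin v)) := fun c v h => dif_neg h
  have hg₀ : ∀ c, ((∀ a b, a < b → g₀ c a ≠ g₀ c b) ∧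
      ∀ v, g₀ c v ≠ Sum.inr (decide (¬ IsMin v))) ∧ ∀ v, (g₀ c v).isLeft ↔ v ∈ W := by
    intro c
    refine ⟨⟨fun a b hab => ?_, fun v => ?_⟩, fun v => ?_⟩
    · by_cases ha : a ∈ W <;> by_cases hb : b ∈ W
      · rw [hin c a ha, hin c b hb]
        intro h
        exact c.valid (v := ⟨a, ha⟩) (w := ⟨b, hb⟩) (hP.hasse_adj.2 (Or.inl hab))
          (Sum.inl_injective h)
      · rw [hin c a ha, hout c b hb]
        exact Sum.inl_ne_inr
      · rw [hout c a ha, hin c b hb]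
        exact Sum.inr_ne_inl
      · have := hP.isMin_and_not_isMin_of_lt hab
        rw [hout c a ha, hout c b hb]
        simp [this]
    · by_cases hv : v ∈ W
      · rw [hin c v hv]
        exact Sum.inl_ne_inr
      · rw [hout c v hv]
        by_cases hm : IsMin v <;> simp only [hm, decide_true, decide_false, not_true, not_false_iff,
          ne_eq, Sum.inr.injEq, Bool.true_eq_false, Bool.false_eq_true]
    · by_cases hv : v ∈ W
      · simp [hin c v hv, hv]
      · simp [hout c v hv, hv]
  let g : ((SimpleGraph.hasse P).induce (W : Set P)).Coloring (Fin q) →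
      {x : P → Fin q ⊕ Bool // ((∀ a b, a < b → x a ≠ x b) ∧
        ∀ v, x v ≠ Sum.inr (decide (¬ IsMin v))) ∧ ∀ v, (x v).isLeft ↔ v ∈ W} :=
    fun c => ⟨g₀ c, hg₀ c⟩
  have hg : Function.Bijective g := by
    constructor
    · intro c d h
      refine RelHom.ext fun v => ?_
      have := congrFun (congrArg Subtype.val h) v.1
      change g₀ c v.1 = g₀ d v.1 at this
      rw [hin c v.1 v.2, hin d v.1 v.2] at this
      exact Sum.inl_injective this
    · rintro ⟨x, ⟨hx, hx'⟩, hW⟩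
      have hleft : ∀ v (h : v ∈ W), Sum.inl ((x v).getLeft ((hW v).2 h)) = x v := fun v h =>
        Sum.inl_getLeft _ _
      refine ⟨SimpleGraph.Coloring.mk (fun v => (x v.1).getLeft ((hW v.1).2 v.2)) ?_, ?_⟩
      · intro v w hvw h
        have h' : x v.1 = x w.1 := by
          rw [← hleft v.1 v.2, ← hleft w.1 w.2]
          exact congrArg Sum.inl h
        rcases hP.hasse_adj.1 hvw with h1 | h1
        exacts [hx _ _ h1 h', hx _ _ h1 h'.symm]
      · refine Subtype.ext (funext fun v => ?_)
        change g₀ _ v = x v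
        by_cases hv : v ∈ W
        · rw [hin _ v hv]
          exact hleft v hv
        · rw [hout _ v hv]
          have h1 := hx' v
          have h2 := mt (hW v).1 hv
          rcases hxv : x v with y | b
          · rw [hxv] at h2
            simp at h2
          · rw [hxv] at h1
            by_cases hm : IsMin v <;> simp_all
  rw [Nat.card_congr (Equiv.ofBijective g hg)]
  refine (Nat.subtype_card _ fun x => ?_).symm
  rw [Finset.mem_filter, hA, Finset.mem_filter, Finset.ext_iff]
  simp

/-- The characteristic polynomial of the visibility arrangement of the order polytope of a poset of
rank one, in terms of chromatic polynomials. -/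
theorem IsGradedOfRankOne.whitneyPolynomial_eq {P : Type*} [PartialOrder P] [Fintype P]
    [Fintype (OrderPolytopeIndex P)] (hP : IsGradedOfRankOne P) :
    whitneyPolynomial (fun i : OrderPolytopeIndex P => (orderPolytopeFunctional i).zeroLocus)
      Finset.univ ⊤ =
    ∑ W : Finset P, ((SimpleGraph.hasse P).induce (W : Set P)).chromaticPolynomial.comp
      (Polynomial.X - Polynomial.C 2) := by
  refine Polynomial.eq_of_infinite_eval_eq _ _ ?_
  -- Agreement at all `q + 2` suffices; the shift by two accounts for the special colors.
  refine (Set.infinite_range_of_injective (f := fun q : ℕ => (q : ℤ) + 2)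
    fun a b h => by simpa using h).mono ?_
  rintro _ ⟨q, rfl⟩
  have hk : Function.Injective fun b : Bool => if b then (1 : ℝ) else 0 := by
    intro a b
    cases a <;> cases b <;> simp
  have h := eval_whitneyPolynomial_card (orderPolytopeEquation (P := P)) hk
    (Sum.inr_injective (α := Fin q) (β := Bool)) _ mem_zeroLocus_orderPolytopeFunctional
  rw [hP.card_avoiding] at h
  have hq : (Nat.card (Fin q ⊕ Bool) : ℤ) = (q : ℤ) + 2 := by simp
  rw [hq] at h
  rw [Set.mem_ofPred_eq, h, Polynomial.eval_finsetSum, Nat.cast_sum]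
  refine Finset.sum_congr rfl fun W _ => ?_
  rw [Polynomial.eval_comp, ← SimpleGraph.eval_chromaticPolynomial]
  simp

/-! ### The theorem for order polytopes. -/

theorem mainTheorem7 (P : Type*) [PartialOrder P] [Fintype P] (hP : IsGradedOfRankOne P) :
    ∃ hA : (visibilityArrangement (orderPolytope P)).Finite,
      characteristicPolynomial (visibilityArrangement (orderPolytope P)) hA =
          ∑ W : Finset P,
            ((SimpleGraph.hasse P).induce (W : Set P)).chromaticPolynomial.comp
              (Polynomial.X - Polynomial.C 2) ∧
      (regions (visibilityArrangement (orderPolytope P))).Finite ∧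
      (visibilityNumber (orderPolytope P) : ℤ) =
          (-1) ^ Fintype.card P *
            ∑ W : Finset P,
              ((SimpleGraph.hasse P).induce (W : Set P)).chromaticPolynomial.eval (-3) ∧
      (visibilitySets (orderPolytope P)).ncard = visibilityNumber (orderPolytope P) := by
  have := Fintype.ofFinite (OrderPolytopeIndex P)
  have hp := hP.orderPolytopeFunctional_center_pos
  have hw := orderPolytopeFunctional_facetPoint (P := P)
  have hw' := hP.orderPolytopeFunctional_facetPoint_pos
  have hvis := visibilityArrangement_polyhedron hp hw hw'
  have hsets := ncard_visibilitySets_polyhedron hp hw hw'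
  rw [hP.polyhedron_eq_orderPolytope] at hvis hsets
  have hproper : ∀ i : OrderPolytopeIndex P, (orderPolytopeFunctional i).zeroLocus ≠ ⊤ :=
    fun i h => (hp i).ne' (AffineMap.mem_zeroLocus.1 (h ▸ AffineSubspace.mem_top ℝ _ _))
  refine ⟨hvis ▸ Set.finite_range _, ?_, ?_, ?_, ?_⟩
  · rw [characteristicPolynomial_eq_whitneyPolynomial _ hproper _ hvis, hP.whitneyPolynomial_eq]
  · rw [hvis]
    exact finite_regions _
  -- With `S` the whole space, the sign exponent is the dimension `#P`, and the argument `-1 - 2` is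
  -- `-3`.
  · have h := eval_whitneyPolynomial_neg_one (orderPolytopeFunctional (P := P)) Finset.univ ⊤
    rw [hP.whitneyPolynomial_eq, AffineSubspace.direction_top, finrank_top,
      Module.finrank_fintype_fun_eq_card, Polynomial.eval_finsetSum] at h
    rw [visibilityNumber, hvis, ncard_regions]
    have hsum : ∑ W : Finset P,
        ((SimpleGraph.hasse P).induce (W : Set P)).chromaticPolynomial.eval (-3) =
        (-1) ^ Fintype.card P *
          ((signPatterns (orderPolytopeFunctional (P := P)) Finset.univ Set.univ).ncard : ℤ) := by
      refine (Finset.sum_congr rfl fun W _ => ?_).trans h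
      rw [Polynomial.eval_comp]
      norm_num
    rw [hsum, ← mul_assoc, ← mul_pow]
    simp
  · rw [hsets, visibilityNumber, hvis, ncard_regions]
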